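/- Let $\mathcal{T}$ be a compact $3$-manifold triangulation: finitely many tetrahedra $\Delta_1,\dots,\Delta_n$, some or all of whose faces are affinely identified in pairs, so that the resulting space is a compact $3$-manifold, possibly with boundary (so every vertex link is a disc or a $2$-sphere, and no edge is identified with itself in reverse). For an embedded normal surface $S$ in $\mathcal{T}$, let $\mathbf{v}(S)\in\mathbb{R}^{7n}$ be the vector that counts the discs of $S$ of each of the four triangle types and three quadrilateral types in each tetrahedron, and let $\mathbf{q}(S)\in\mathbb{R}^{3n}$ be its quadrilateral part. Let $\mathscr{S}(\mathcal{T})\subset\mathbb{R}^{7n}$ (respectively $\mathscr{Q}(\mathcal{T})\subset\mathbb{R}^{3n}$) be the polytope of all vectors with non-negative coordinates of sum $1$ that satisfy Haken's standard matching equations (respectively Tollefson's quadrilateral matching equations). For a vector $\mathbf{x}\ne\mathbf{0}$ with non-negative coordinates, its projective image is $\overline{\mathbf{x}}=\mathbf{x}/\sum_i x_i$; also $\overline{\mathbf{0}}=\mathbf{0}$. The surface $S$ is a standard (respectively quadrilateral) vertex normal surface if $\overline{\mathbf{v}(S)}$ is a vertex of $\mathscr{S}(\mathcal{T})$ (respectively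 $\overline{\mathbf{q}(S)}$ is a vertex of $\mathscr{Q}(\mathcal{T})$). The canonical part of $S$ is the surface obtained from $S$ by removing all vertex linking components. A vector satisfies the quadrilateral constraints if in each tetrahedron at most one of its three quadrilateral coordinates is non-zero. A vector in $\mathbb{R}^{7n}$ is admissible if it is non-negative and satisfies the standard matching equations and the quadrilateral constraints. It is canonical if its triangular coordinates are non-negative and, for each vertex $V$ of $\mathcal{T}$, at least one of the coordinates of the triangles surrounding $V$ is zero. A canonical extension of $\mathbf{w}\in\mathbb{R}^{3n}$ is an admissible canonical vector in $\mathbb{R}^{7n}$ whose quadrilateral coordinates are those of $\mathbf{w}$. Then: 1. The canonical part of every quadrilateral vertex normal surface in $\mathcal{T}$ is a standard vertex normal surface in $\mathcal{T}$. 2. Every vertex $\mathbf{w}$ of $\mathscr{Q}(\mathcal{T})$ that satisfies the quadrilateral constraints has exactly one canonical extension $\varepsilon(\mathbf{w})$, and the projective image $\overline{\varepsilon(\mathbf{w})}$ is a vertex of $\mathscr{S}(\mathcal{T})$. -/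

import Mathlib

/-! Normal surfaces in compact 3-manifold triangulations, in standard and quadrilateral
coordinates. -/

namespace NormalSurf

/-! ### Triangulations -/

/-- Tetrahedra `0, …, n - 1`, each with vertices `0, 1, 2, 3`, where face `f` of a tetrahedron is
the one opposite vertex `f`, together with affine identifications of some of the faces in pairs.
`glue i f = none` says that face `f` of tetrahedron `i` is a boundary face. `glue i f = some (j, σ)`
says that it is glued to face `σ f` of tetrahedron `j`, each vertex `v ≠ f` of the face going to
vertex `σ v`. A face is never glued to itself. -/
structure FaceGluing (n : ℕ) where
  glue : Fin n → Fin 4 → Option (Fin n × Equiv.Perm (Fin 4))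
  symm : ∀ i f j σ, glue i f = some (j, σ) → glue j (σ f) = some (i, σ⁻¹)
  ne_self : ∀ i f j σ, glue i f = some (j, σ) → (j, σ f) ≠ (i, f)

/-- A tetrahedron with an ordered pair of distinct vertices. -/
abbrev Flag (n : ℕ) : Type := {p : Fin n × Fin 4 × Fin 4 // p.2.1 ≠ p.2.2}

namespace FaceGluing

variable {n : ℕ} (T : FaceGluing n)

/-- Corner `p` (a vertex of a tetrahedron) is identified with corner `q` by a single gluing. -/
def CornerGlued (p q : Fin n × Fin 4) : Prop :=
  ∃ f σ, p.2 ≠ f ∧ T.glue p.1 f = some (q.1, σ) ∧ q.2 = σ p.2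

/-- The vertices of the triangulation: classes of tetrahedron vertices. -/
def Vertex : Type := Quot T.CornerGlued

/-- The vertex of the triangulation at vertex `v` of tetrahedron `i`. -/
def vertexAt (i : Fin n) (v : Fin 4) : T.Vertex := Quot.mk _ (i, v)

/-- Here a flag `(i, a, b)` is the edge of tetrahedron `i` directed from vertex `a` to vertex `b`;
a single gluing identifies two such directed edges. -/
def EdgeGlued (p q : Flag n) : Prop :=
  ∃ f σ, p.1.2.1 ≠ f ∧ p.1.2.2 ≠ f ∧ T.glue p.1.1 f = some (q.1.1, σ) ∧
    q.1.2.1 = σ p.1.2.1 ∧ q.1.2.2 = σ p.1.2.2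

/-- The directed edges of the triangulation. -/
def DirectedEdge : Type := Quot T.EdgeGlued

/-- The directed edge of the triangulation that contains a given directed tetrahedron edge. -/
def directedEdge (p : Flag n) : T.DirectedEdge := Quot.mk _ p

/-- Here a flag `(i, v, f)` is the arc, in face `f` of tetrahedron `i`, of a small triangle that
cuts off vertex `v`; a gluing of that face identifies two such arcs. -/
def LinkArcGlued (p q : Flag n) : Prop :=
  ∃ σ, T.glue p.1.1 p.1.2.2 = some (q.1.1, σ) ∧ q.1.2.1 = σ p.1.2.1 ∧ q.1.2.2 = σ p.1.2.2

/-- The edges of all vertex links. -/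
def LinkArc : Type := Quot T.LinkArcGlued

/-- The edge of a vertex link that contains a given arc. -/
def linkArc (p : Flag n) : T.LinkArc := Quot.mk _ p

/-- The 0-cells of the link of `V`: the directed edges that start at `V`. -/
def linkZeroCells (V : T.Vertex) : Set T.DirectedEdge :=
  {E | ∃ p : Flag n, T.directedEdge p = E ∧ T.vertexAt p.1.1 p.1.2.1 = V}

/-- The 1-cells of the link of `V`. -/
def linkOneCells (V : T.Vertex) : Set T.LinkArc :=
  {A | ∃ p : Flag n, T.linkArc p = A ∧ T.vertexAt p.1.1 p.1.2.1 = V}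

/-- The 2-cells of the link of `V`: one triangle for each tetrahedron corner at `V`. -/
def linkTwoCells (V : T.Vertex) : Set (Fin n × Fin 4) :=
  {c | T.vertexAt c.1 c.2 = V}

/-- The Euler characteristic of the link of `V`. -/
noncomputable def linkEulerChar (V : T.Vertex) : ℤ :=
  (T.linkZeroCells V).ncard - (T.linkOneCells V).ncard + (T.linkTwoCells V).ncard

/-- `V` lies on some boundary face, i.e. the link of `V` has non-empty boundary. -/
def OnBoundary (V : T.Vertex) : Prop :=
  ∃ i v f, v ≠ f ∧ T.vertexAt i v = V ∧ T.glue i f = none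

/-- The space obtained from the gluing is a compact 3-manifold (possibly with boundary, possibly
disconnected): no edge is identified with itself in reverse, and every vertex link is a 2-sphere or
a disc. Vertex links are connected compact surfaces, so by the classification of surfaces a link is
a 2-sphere iff it has no boundary and Euler characteristic 2, and a disc iff it has
boundary and Euler characteristic 1. -/
def IsThreeManifold : Prop :=
  (∀ (i : Fin n) (a b : Fin 4) (h : a ≠ b),
    T.directedEdge ⟨(i, a, b), h⟩ ≠ T.directedEdge ⟨(i, b, a), h.symm⟩) ∧
  ∀ V : T.Vertex, (¬ T.OnBoundary V ∧ T.linkEulerChar V = 2) ∨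
    (T.OnBoundary V ∧ T.linkEulerChar V = 1)

end FaceGluing

/-! ### Disc types and coordinates -/

/-- The quadrilateral type that separates the edge `ab` from the opposite edge, for `a ≠ b`: type
`0` is `01|23`, type `1` is `02|13`, type `2` is `03|12`. (The diagonal entries are unused.) -/
def quadType : Fin 4 → Fin 4 → Fin 3 :=
  ![![0, 0, 1, 2], ![0, 0, 2, 1], ![1, 2, 0, 0], ![2, 1, 0, 0]]

/-- The seven types of normal disc: `inl v` is the triangle type surrounding vertex `v`, `inr k` is
the `k`-th quadrilateral type. -/
abbrev DiscType : Type := Fin 4 ⊕ Fin 3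

/-- A disc of the given type separates the tetrahedron vertices `a` and `b`, i.e. it meets the
edge `ab`. -/
def DiscType.Separates : DiscType → Fin 4 → Fin 4 → Prop
  | Sum.inl v, a, b => a ≠ b ∧ (a = v ∨ b = v)
  | Sum.inr k, a, b => a ≠ b ∧ quadType a b ≠ k

/-- The space `ℝ⁷ⁿ` of standard coordinates. -/
abbrev StdVec (n : ℕ) : Type := Fin n × DiscType → ℝ

/-- The space `ℝ³ⁿ` of quadrilateral coordinates. -/
abbrev QuadVec (n : ℕ) : Type := Fin n × Fin 3 → ℝ

/-- The quadrilateral projection `ℝ⁷ⁿ → ℝ³ⁿ`. -/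
def quadProj {n : ℕ} (w : StdVec n) : QuadVec n := fun p => w (p.1, Sum.inr p.2)

/-- The projective image: the vector divided by the sum of its coordinates (`0` goes to `0`). -/
noncomputable def projImage {ι : Type*} [Fintype ι] (x : ι → ℝ) : ι → ℝ := (∑ c, x c)⁻¹ • x

/-- At most one quadrilateral coordinate in each tetrahedron is non-zero. -/
def QuadConstraints {n : ℕ} (q : QuadVec n) : Prop :=
  ∀ i k l, q (i, k) ≠ 0 → q (i, l) ≠ 0 → k = l

namespace FaceGluing

variable {n : ℕ} (T : FaceGluing n)

/-- The standard matching equations. If face `f` of tetrahedron `i` is glued to another face, and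
`v` is a vertex of that face, then the discs that meet the face in an arc cutting off `v`
(parallel to the edge of the face opposite `v`) are the triangles around `v` and the quadrilaterals
that separate the edge `vf` from the opposite edge. -/
def StdMatching (w : StdVec n) : Prop :=
  ∀ i f j σ, T.glue i f = some (j, σ) → ∀ v, v ≠ f →
    w (i, Sum.inl v) + w (i, Sum.inr (quadType v f)) =
      w (j, Sum.inl (σ v)) + w (j, Sum.inr (quadType (σ v) (σ f)))

/-- One step around an edge. A pair `(i, p)` stands for the edge of tetrahedron `i` with lower end
`p 0` and upper end `p 1`, when the tetrahedron is entered through the face opposite `p 2` and left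
through the face opposite `p 3`. -/
def TurnStep (s s' : Fin n × Equiv.Perm (Fin 4)) : Prop :=
  ∃ σ, T.glue s.1 (s.2 3) = some (s'.1, σ) ∧ s'.2 = σ * s.2 * Equiv.swap 2 3

/-- `s'` is reached from `s` by going around the edge. -/
def Around (s s' : Fin n × Equiv.Perm (Fin 4)) : Prop := Relation.ReflTransGen T.TurnStep s s'

/-- The edge of `s` is a non-boundary edge: going around it one never meets a boundary face (so one
runs through a cycle). -/
def NonBoundaryEdge (s : Fin n × Equiv.Perm (Fin 4)) : Prop :=
  ∀ s', T.Around s s' → T.glue s'.1 (s'.2 3) ≠ none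

open Classical in
/-- The quadrilateral matching equations: for each non-boundary edge, with a choice of its lower and
upper ends and of a direction around it, the sum of the coordinates of the upward quadrilaterals
equals that of the downward ones. In a tetrahedron `(i, p)` of the cycle the upward quadrilaterals
cut off the lower end `p 0` in the face opposite `p 2`, through which one enters, and cut off the
upper end `p 1` in the face opposite `p 3`, through which one leaves; they separate the edge
`p 0 p 2` from `p 1 p 3`. The downward ones separate `p 0 p 3` from `p 1 p 2`. -/
def QuadMatching (q : QuadVec n) : Prop :=
  ∀ s, T.NonBoundaryEdge s →
    ∑ s' : Fin n × Equiv.Perm (Fin 4) with T.Around s s',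
        q (s'.1, quadType (s'.2 0) (s'.2 2)) =
      ∑ s' : Fin n × Equiv.Perm (Fin 4) with T.Around s s',
        q (s'.1, quadType (s'.2 0) (s'.2 3))

/-- Admissible vectors in standard coordinates. -/
def StdAdmissible (w : StdVec n) : Prop :=
  (∀ c, 0 ≤ w c) ∧ T.StdMatching w ∧ QuadConstraints (quadProj w)

/-- The standard projective solution space. -/
def stdSolutionSpace : Set (StdVec n) :=
  {w | (∀ c, 0 ≤ w c) ∧ ∑ c, w c = 1 ∧ T.StdMatching w}

/-- The quadrilateral projective solution space. -/
def quadSolutionSpace : Set (QuadVec n) :=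
  {q | (∀ c, 0 ≤ q c) ∧ ∑ c, q c = 1 ∧ T.QuadMatching q}

/-- The quadrilateral solution set: the vertices of the quadrilateral projective solution space that
satisfy the quadrilateral constraints. -/
def quadSolutionSet : Set (QuadVec n) :=
  {q | q ∈ T.quadSolutionSpace.extremePoints ℝ ∧ QuadConstraints q}

open Classical in
/-- The standard vector of the vertex link of `V`: one triangle of each type surrounding `V` and
nothing else. -/
noncomputable def vertexLink (V : T.Vertex) : StdVec n
  | (i, Sum.inl v) => if T.vertexAt i v = V then 1 else 0
  | (_, Sum.inr _) => 0

/-- Canonical vectors: all triangular coordinates are non-negative, and subtracting any positive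
multiple of any vertex link makes some triangular coordinate negative. -/
def IsCanonical (w : StdVec n) : Prop :=
  (∀ i v, 0 ≤ w (i, Sum.inl v)) ∧
  ∀ V : T.Vertex, ∀ ε : ℝ, 0 < ε → ∃ i v, (w - ε • T.vertexLink V) (i, Sum.inl v) < 0

/-- `x` is the canonical extension of `q`: an admissible canonical vector in standard coordinates
whose quadrilateral projection is `q`. -/
def IsCanonicalExtension (q : QuadVec n) (x : StdVec n) : Prop :=
  T.StdAdmissible x ∧ T.IsCanonical x ∧ quadProj x = q

end FaceGluing

/-! ### Embedded normal surfaces -/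

/-- A normal disc in a tetrahedron, up to an isotopy of its interior. It is given by its type and by
the points in which it meets the edges: it meets an edge `ab` whose ends it separates in exactly one
interior point, and `pos a b` is the distance of that point from `a` (every edge has length `1`). In
the faces the boundary of the disc runs along straight arcs between these points. -/
@[ext]
structure NormalDisc where
  type : DiscType
  pos : Fin 4 → Fin 4 → ℝ
  pos_pos : ∀ a b, type.Separates a b → 0 < pos a b
  pos_add : ∀ a b, type.Separates a b → pos a b + pos b a = 1
  pos_eq_zero : ∀ a b, ¬ type.Separates a b → pos a b = 0

namespace NormalDisc

/-- The point of the disc on the edge `ab`, in barycentric coordinates of the tetrahedron. -/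
noncomputable def corner (D : NormalDisc) (a b : Fin 4) : Fin 4 → ℝ :=
  Pi.single a (D.pos b a) + Pi.single b (D.pos a b)

/-- The arc in which the disc meets face `f`: the segment between its two points on the edges of
that face (empty for a triangle that surrounds vertex `f`). -/
noncomputable def arc (D : NormalDisc) (f : Fin 4) : Set (Fin 4 → ℝ) :=
  convexHull ℝ {x | ∃ a b, a ≠ f ∧ b ≠ f ∧ D.type.Separates a b ∧ x = D.corner a b}

/-- The boundary curve of the disc. -/
noncomputable def boundary (D : NormalDisc) : Set (Fin 4 → ℝ) := ⋃ f, D.arc f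

end NormalDisc

/-- The affine identification of two faces given by `σ`, in barycentric coordinates. -/
def faceMap (σ : Equiv.Perm (Fin 4)) (x : Fin 4 → ℝ) : Fin 4 → ℝ := fun v => x (σ⁻¹ v)

/-- An embedded normal surface (straightened in the faces by a normal isotopy): in each tetrahedron
a finite collection of normal discs that are pairwise disjoint, such that the arcs in any two faces
that are glued together agree. (Discs in a tetrahedron can be chosen disjoint, in an essentially
unique way, iff their boundary curves are disjoint.) The empty surface and disconnected surfaces are
allowed. -/
@[ext]
structure NormalSurface {n : ℕ} (T : FaceGluing n) where
  discs : Fin n → Set NormalDisc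
  finite : ∀ i, (discs i).Finite
  disjoint : ∀ i, (discs i).Pairwise fun D D' => Disjoint D.boundary D'.boundary
  matching : ∀ i f j σ, T.glue i f = some (j, σ) → ∀ D ∈ discs i, (D.arc f).Nonempty →
    ∃ D' ∈ discs j, D'.arc (σ f) = faceMap σ '' D.arc f

/-- The number of discs of each type in each tetrahedron, for a set of discs. -/
noncomputable def discCount {n : ℕ} (C : Set (Fin n × NormalDisc)) : StdVec n :=
  fun c => ({D | (c.1, D) ∈ C ∧ D.type = c.2}.ncard : ℝ)

namespace NormalSurface

variable {n : ℕ} {T : FaceGluing n} (S : NormalSurface T)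

/-- All discs of the surface, each with its tetrahedron. -/
def allDiscs : Set (Fin n × NormalDisc) := {p | p.2 ∈ S.discs p.1}

/-- Two discs of the surface are joined along an arc in a common face of their tetrahedra. -/
def Joined (p q : Fin n × NormalDisc) : Prop :=
  p ∈ S.allDiscs ∧ q ∈ S.allDiscs ∧
  ∃ f σ, T.glue p.1 f = some (q.1, σ) ∧ (p.2.arc f).Nonempty ∧
    q.2.arc (σ f) = faceMap σ '' p.2.arc f

/-- The connected component of the surface that contains the disc `p`, as a set of discs. -/
def component (p : Fin n × NormalDisc) : Set (Fin n × NormalDisc) :=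
  {q | Relation.EqvGen S.Joined p q}

/-- The disc `p` lies in a vertex linking component. -/
def InVertexLink (p : Fin n × NormalDisc) : Prop :=
  ∃ V : T.Vertex, discCount (S.component p) = T.vertexLink V

theorem inVertexLink_of_joined {p q : Fin n × NormalDisc} (h : S.Joined p q)
    (hq : S.InVertexLink q) : S.InVertexLink p := by
  obtain ⟨V, hV⟩ := hq
  refine ⟨V, ?_⟩
  rw [← hV]
  congr 1
  ext r
  exact ⟨fun hr => .trans _ _ _ (.symm _ _ (.rel _ _ h)) hr, fun hr => .trans _ _ _ (.rel _ _ h) hr⟩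

/-- The canonical part of a surface: all vertex linking components are removed. -/
def canonicalPart : NormalSurface T where
  discs i := {D ∈ S.discs i | ¬ S.InVertexLink (i, D)}
  finite i := (S.finite i).subset fun _ h => h.1
  disjoint i := (S.disjoint i).mono fun _ h => h.1
  matching := by
    rintro i f j σ hg D ⟨hD, hL⟩ hne
    obtain ⟨D', hD', he⟩ := S.matching i f j σ hg D hD hne
    exact ⟨D', ⟨hD', fun h => hL (S.inVertexLink_of_joined ⟨hD, hD', f, σ, hg, hne, he⟩ h)⟩, he⟩

/-- The standard vector representation. -/
noncomputable def stdRep : StdVec n := discCount S.allDiscs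

/-- The quadrilateral vector representation. -/
noncomputable def quadRep : QuadVec n :=
  fun c => ({D | D ∈ S.discs c.1 ∧ D.type = Sum.inr c.2}.ncard : ℝ)

/-- Standard vertex normal surfaces. -/
def IsStdVertex : Prop := projImage S.stdRep ∈ T.stdSolutionSpace.extremePoints ℝ

/-- Quadrilateral vertex normal surfaces. -/
def IsQuadVertex : Prop := projImage S.quadRep ∈ T.quadSolutionSpace.extremePoints ℝ

end NormalSurface

end NormalSurf

/-! Fix the quadrilateral part `q`. The standard matching equations then ask for a function on the
corners, that is, on the 2-cells of the vertex links, whose difference across every link arc is the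
prescribed antisymmetric cochain `quadDiff q`. Tollefson's equations say that this cochain has zero
circulation around every interior 0-cell of the links. The links are spheres and discs, so their
first cohomology vanishes and the cochain is a coboundary (`mem_range_cornerCob`). The vanishing is
proved by counting dimensions of pairwise orthogonal spaces with the Euler characteristics, without
orienting the links. The kernel of the coboundary consists of the functions constant on each link,
so solutions over the same `q` differ by combinations of vertex links. Subtracting at each vertex
the minimal triangle coordinate yields the only canonical solution.

Let `x` be canonical over an extreme ray and let `x = u + v` with non-negative solutions `u`, `v`.
Extremality makes the quadrilateral part of `u` equal to `r` times that of `x`, so `u - r x` is a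
combination of vertex links. Around each vertex some coordinate of `x` vanishes, hence also that of
`u`, so all coefficients are zero and `u = r x` (`IsCanonical.projImage_mem_extremePoints`).

For surfaces it remains to see that the canonical part has a canonical vector. If every triangle
coordinate around a vertex were non-zero, the innermost triangles at its corners would match across
all glued faces, because gluings preserve the nesting of arcs. They would form a complete vertex
linking component, which has been removed. Removing such components does not affect quadrilaterals.
-/

namespace NormalSurf

/-- A tetrahedron with an ordering of its vertices. -/
abbrev OrderedTet (n : ℕ) : Type := Fin n × Equiv.Perm (Fin 4)

/-! ### Crossing faces and turning around edges -/

namespace OrderedTet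

variable {n : ℕ}

/-- Exchange the two faces at the edge. -/
def rev : Equiv.Perm (OrderedTet n) :=
  Function.Involutive.toPerm (fun s => (s.1, s.2 * Equiv.swap 2 3)) fun s => by
    simp [mul_assoc]

theorem rev_apply (s : OrderedTet n) : rev s = (s.1, s.2 * Equiv.swap 2 3) := rfl

theorem rev_rev (s : OrderedTet n) : rev (rev s) = s := by
  simp [rev_apply, mul_assoc]

theorem rev_ne_self (s : OrderedTet n) : rev s ≠ s := by
  intro h
  have h2 : s.2 * Equiv.swap 2 3 = s.2 := congrArg Prod.snd h
  have := congrArg (fun p : Equiv.Perm (Fin 4) => p 2) h2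
  simp at this

/-- The arc at the lower end of the edge in the exit face. -/
def flag (s : OrderedTet n) : Flag n := ⟨(s.1, s.2 0, s.2 3), s.2.injective.ne (by decide)⟩

/-- The directed edge from the lower end to the upper end. -/
def edge (s : OrderedTet n) : Flag n := ⟨(s.1, s.2 0, s.2 1), s.2.injective.ne (by decide)⟩

theorem edge_rev (s : OrderedTet n) : edge (rev s) = edge s := by
  apply Subtype.ext
  simp only [edge, rev_apply, Equiv.Perm.mul_apply]
  congr 1

theorem exists_edge (i : Fin n) {v b f : Fin 4} (hv : v ≠ b) (hf : v ≠ f) (hb : b ≠ f) :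
    ∃ s : OrderedTet n, s.1 = i ∧ s.2 0 = v ∧ s.2 1 = b ∧ s.2 3 = f := by
  have : ∀ v b f : Fin 4, v ≠ b → v ≠ f → b ≠ f →
      ∃ p : Equiv.Perm (Fin 4), p 0 = v ∧ p 1 = b ∧ p 3 = f := by decide
  obtain ⟨p, h⟩ := this v b f hv hf hb
  exact ⟨(i, p), rfl, h⟩

/-- The fibre corresponds to the two ends of the arc: vertices `0` and `3` of the ordering are
prescribed, and the other two can be exchanged. -/
theorem card_flag_fiber (p : Flag n) :
    (Finset.univ.filter fun s : OrderedTet n => flag s = p).card ≤ 2 := by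
  have key : ∀ v f : Fin 4, v ≠ f →
      (Finset.univ.filter fun p : Equiv.Perm (Fin 4) => p 0 = v ∧ p 3 = f).card ≤ 2 := by decide
  obtain ⟨⟨i, v, f⟩, h⟩ := p
  refine le_trans ?_ (key v f h)
  apply Finset.card_le_card_of_injOn Prod.snd
  · intro s hs
    simp only [Finset.coe_filter, Finset.mem_univ, true_and, Set.mem_ofPred_eq, flag,
      Subtype.mk.injEq, Prod.mk.injEq] at hs
    simpa using hs.2
  · intro s hs s' hs' hss
    simp only [Finset.coe_filter, Finset.mem_univ, true_and, Set.mem_ofPred_eq, flag,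
      Subtype.mk.injEq, Prod.mk.injEq] at hs hs'
    exact Prod.ext (hs.1.trans hs'.1.symm) hss

end OrderedTet

namespace FaceGluing

open OrderedTet

variable {n : ℕ} (T : FaceGluing n)

/-- Pass through the exit face, if it is glued. -/
def crossFun (s : OrderedTet n) : OrderedTet n :=
  match T.glue s.1 (s.2 3) with
  | none => s
  | some (j, σ) => (j, σ * s.2)

variable {T} in
theorem crossFun_some {s : OrderedTet n} {j σ} (h : T.glue s.1 (s.2 3) = some (j, σ)) :
    T.crossFun s = (j, σ * s.2) := by
  simp [crossFun, h]

variable {T} in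
theorem crossFun_none {s : OrderedTet n} (h : T.glue s.1 (s.2 3) = none) :
    T.crossFun s = s := by
  simp [crossFun, h]

theorem crossFun_involutive : Function.Involutive T.crossFun := by
  intro s
  rcases h : T.glue s.1 (s.2 3) with _ | ⟨j, σ⟩
  · rw [crossFun_none h, crossFun_none h]
  · have h2 := T.symm _ _ _ _ h
    rw [crossFun_some h, crossFun_some (j := s.1) (σ := σ⁻¹) h2]
    simp

/-- Passing through the exit face, as a permutation. -/
def cross : Equiv.Perm (OrderedTet n) := T.crossFun_involutive.toPerm

theorem cross_apply (s : OrderedTet n) : T.cross s = T.crossFun s := rfl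

theorem cross_cross (s : OrderedTet n) : T.cross (T.cross s) = s := T.crossFun_involutive s

theorem cross_eq_self_iff (s : OrderedTet n) : T.cross s = s ↔ T.glue s.1 (s.2 3) = none := by
  refine ⟨fun h => ?_, fun h => crossFun_none h⟩
  rcases h' : T.glue s.1 (s.2 3) with _ | ⟨j, σ⟩
  · rfl
  · rw [cross_apply, crossFun_some h'] at h
    refine absurd ?_ (T.ne_self _ _ _ _ h')
    have h1 := congrArg Prod.fst h
    have h2 := congrArg (fun t : OrderedTet n => t.2 3) h
    exact Prod.ext h1 h2

/-- Pass from an arc to the one that it is glued to, if there is one. -/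
def flagCrossFun (p : Flag n) : Flag n :=
  match T.glue p.1.1 p.1.2.2 with
  | none => p
  | some (j, σ) => ⟨(j, σ p.1.2.1, σ p.1.2.2), σ.injective.ne p.2⟩

variable {T} in
theorem flagCrossFun_some {p : Flag n} {j σ} (h : T.glue p.1.1 p.1.2.2 = some (j, σ)) :
    T.flagCrossFun p = ⟨(j, σ p.1.2.1, σ p.1.2.2), σ.injective.ne p.2⟩ := by
  simp [flagCrossFun, h]

variable {T} in
theorem flagCrossFun_none {p : Flag n} (h : T.glue p.1.1 p.1.2.2 = none) :
    T.flagCrossFun p = p := by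
  simp [flagCrossFun, h]

theorem flagCrossFun_involutive : Function.Involutive T.flagCrossFun := by
  intro p
  rcases h : T.glue p.1.1 p.1.2.2 with _ | ⟨j, σ⟩
  · rw [flagCrossFun_none h, flagCrossFun_none h]
  · have h2 := T.symm _ _ _ _ h
    rw [flagCrossFun_some h, flagCrossFun_some (j := p.1.1) (σ := σ⁻¹) h2]
    simp

/-- Passing from an arc to the one glued to it, as a permutation. -/
def flagCross : Equiv.Perm (Flag n) := T.flagCrossFun_involutive.toPerm

theorem flagCross_apply (p : Flag n) : T.flagCross p = T.flagCrossFun p := rfl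

theorem flagCross_flagCross (p : Flag n) : T.flagCross (T.flagCross p) = p :=
  T.flagCrossFun_involutive p

theorem flag_cross (s : OrderedTet n) : flag (T.cross s) = T.flagCross (flag s) := by
  rcases h : T.glue s.1 (s.2 3) with _ | ⟨j, σ⟩
  · rw [cross_apply, flagCross_apply, crossFun_none h, flagCrossFun_none (p := flag s) h]
  · rw [cross_apply, flagCross_apply, crossFun_some h, flagCrossFun_some (p := flag s) h]
    rfl

theorem linkArcGlued_iff (p q : Flag n) :
    T.LinkArcGlued p q ↔ T.glue p.1.1 p.1.2.2 ≠ none ∧ q = T.flagCross p := by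
  constructor
  · rintro ⟨σ, h, h1, h2⟩
    refine ⟨by simp [h], ?_⟩
    rw [flagCross_apply, flagCrossFun_some h]
    exact Subtype.ext (Prod.ext rfl (Prod.ext h1 h2))
  · rintro ⟨h, rfl⟩
    rcases h' : T.glue p.1.1 p.1.2.2 with _ | ⟨j, σ⟩
    · exact absurd h' h
    · refine ⟨σ, ?_⟩
      rw [flagCross_apply, flagCrossFun_some h']
      exact ⟨h', rfl, rfl⟩

theorem linkArc_flagCross (p : Flag n) : T.linkArc (T.flagCross p) = T.linkArc p := by
  by_cases h : T.glue p.1.1 p.1.2.2 = none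
  · rw [flagCross_apply, flagCrossFun_none h]
  · exact (Quot.sound ((T.linkArcGlued_iff _ _).2 ⟨h, rfl⟩)).symm

/-- Crossing is an involution, so the generated equivalence relation closes up after one step. -/
theorem linkArc_eq_iff (p q : Flag n) :
    T.linkArc p = T.linkArc q ↔ q = p ∨ q = T.flagCross p := by
  constructor
  · intro h
    have h' := Quot.eqvGen_exact h
    induction h' with
    | rel x y hxy => exact .inr ((T.linkArcGlued_iff _ _).1 hxy).2
    | refl x => exact .inl rfl
    | symm x y _ ih =>
      rcases ih (Quot.eqvGen_sound ‹_›) with rfl | rfl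
      · exact .inl rfl
      · exact .inr (T.flagCross_flagCross _).symm
    | trans x y z h1 h2 ih1 ih2 =>
      rcases ih1 (Quot.eqvGen_sound h1) with rfl | rfl <;>
        rcases ih2 (Quot.eqvGen_sound h2) with rfl | rfl <;>
        simp [T.flagCross_flagCross]
  · rintro (rfl | rfl)
    · rfl
    · exact (T.linkArc_flagCross p).symm

/-- The directed edge of the triangulation below an ordered tetrahedron. -/
def edgeAt (s : OrderedTet n) : T.DirectedEdge := T.directedEdge (edge s)

theorem edgeAt_rev (s : OrderedTet n) : T.edgeAt (rev s) = T.edgeAt s := by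
  rw [edgeAt, edge_rev, edgeAt]

theorem edgeAt_cross (s : OrderedTet n) : T.edgeAt (T.cross s) = T.edgeAt s := by
  rcases h : T.glue s.1 (s.2 3) with _ | ⟨j, σ⟩
  · rw [cross_apply, crossFun_none h]
  · rw [cross_apply, crossFun_some h]
    exact (Quot.sound ⟨s.2 3, σ, s.2.injective.ne (by decide), s.2.injective.ne (by decide),
      h, rfl, rfl⟩).symm

/-- One step around the edge, as a permutation (one turns back at a boundary face). -/
def turn : Equiv.Perm (OrderedTet n) := rev * T.cross

theorem turn_apply (s : OrderedTet n) : T.turn s = rev (T.cross s) := rfl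

theorem cross_eq_rev_turn (s : OrderedTet n) : T.cross s = rev (T.turn s) := by
  rw [turn_apply, rev_rev]

theorem turn_inv : T.turn⁻¹ = T.cross * rev := by
  ext1 s
  rw [Equiv.Perm.inv_eq_iff_eq]
  simp [turn_apply, cross_cross, rev_rev]

theorem edgeAt_turn (s : OrderedTet n) : T.edgeAt (T.turn s) = T.edgeAt s := by
  rw [turn_apply, edgeAt_rev, edgeAt_cross]

theorem edgeAt_turn_zpow (k : ℤ) (s : OrderedTet n) :
    T.edgeAt ((T.turn ^ k) s) = T.edgeAt s := by
  induction k with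
  | zero => rfl
  | succ k ih => rw [add_comm, zpow_add, zpow_one, Equiv.Perm.mul_apply, edgeAt_turn, ih]
  | pred k ih =>
    rw [sub_eq_neg_add, zpow_add, zpow_neg_one, Equiv.Perm.mul_apply, ← T.edgeAt_turn]
    simpa using ih

theorem edgeAt_eq_of_sameCycle {s t : OrderedTet n} (h : T.turn.SameCycle s t) :
    T.edgeAt s = T.edgeAt t := by
  obtain ⟨k, rfl⟩ := h
  rw [edgeAt_turn_zpow]

/-- A directed edge that lies on a boundary face. -/
def IsBdryEdge (E : T.DirectedEdge) : Prop := ∃ s, T.edgeAt s = E ∧ T.cross s = s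

/-- `turn` is the product of the involutions `rev` and `cross`, so the two generate a dihedral
action in which `rev` inverts `turn`. -/
theorem rev_conj_turn_zpow (k : ℤ) (s : OrderedTet n) :
    rev ((T.turn ^ k) s) = (T.turn ^ (-k)) (rev s) := by
  have h : rev * T.turn * rev⁻¹ = T.turn⁻¹ := by
    rw [turn_inv]
    ext1 s
    have : (rev⁻¹ : Equiv.Perm (OrderedTet n)) = rev := by
      ext1 t
      rw [Equiv.Perm.inv_eq_iff_eq, rev_rev]
    rw [this]
    simp [turn_apply, rev_rev]
  have h2 : rev * T.turn ^ k * rev⁻¹ = T.turn ^ (-k) := by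
    rw [← conj_zpow, h, inv_zpow, zpow_neg]
  rw [← h2]
  simp

/-- Only at a boundary edge does turning around lead to the opposite direction. -/
theorem isBdryEdge_of_sameCycle_rev {s : OrderedTet n} (h : T.turn.SameCycle s (rev s)) :
    T.IsBdryEdge (T.edgeAt s) := by
  obtain ⟨k, hk⟩ := h
  -- Look at the midpoint of the way from `s` to `rev s`. For even `k` it would be fixed by `rev`,
  -- which is impossible; for odd `k` it is fixed by `cross`, which is a boundary face.
  obtain ⟨m, rfl | rfl⟩ := Int.even_or_odd' k
  · refine absurd ?_ (rev_ne_self ((T.turn ^ m) s))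
    rw [rev_conj_turn_zpow, ← hk, ← Equiv.Perm.mul_apply, ← zpow_add]
    congr 2
    ring
  · refine ⟨(T.turn ^ m) s, T.edgeAt_turn_zpow m s, ?_⟩
    rw [cross_eq_rev_turn, ← Equiv.Perm.mul_apply T.turn, ← zpow_one_add,
      rev_conj_turn_zpow, ← hk, ← Equiv.Perm.mul_apply, ← zpow_add]
    congr 2
    ring

theorem sameCycle_rev {s t : OrderedTet n} (h : T.turn.SameCycle s t) :
    T.turn.SameCycle (rev s) (rev t) := by
  obtain ⟨k, rfl⟩ := h
  exact ⟨-k, (T.rev_conj_turn_zpow k s).symm⟩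

/-- The cycles around edges can be directed so that the two directions differ by a sign. -/
theorem exists_sign : ∃ e : OrderedTet n → ℝ,
    (∀ s, e (T.turn s) = e s) ∧ (∀ s, e (rev s) = -e s) ∧
    (∀ s, T.IsBdryEdge (T.edgeAt s) → e s = 0) ∧
    ∀ s, ¬ T.IsBdryEdge (T.edgeAt s) → |e s| = 1 := by
  classical
  let Q := Quotient (Equiv.Perm.SameCycle.setoid T.turn)
  let mk : OrderedTet n → Q := Quotient.mk _
  -- An arbitrary numbering of the cycles selects one from each pair of opposite cycles.
  obtain ⟨r, hr⟩ : ∃ r : Q → ℕ, Function.Injective r := by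
    obtain ⟨m, ⟨e⟩⟩ := Finite.exists_equiv_fin Q
    exact ⟨fun x => e x, Fin.val_injective.comp e.injective⟩
  have hturn : ∀ s, mk (T.turn s) = mk s := fun s =>
    Quotient.sound (s := Equiv.Perm.SameCycle.setoid T.turn) ⟨-1, by simp⟩
  have hrev : ∀ s, mk (rev (T.turn s)) = mk (rev s) := fun s =>
    Quotient.sound (s := Equiv.Perm.SameCycle.setoid T.turn)
      (T.sameCycle_rev ⟨-1, by simp⟩)
  refine ⟨fun s => if T.IsBdryEdge (T.edgeAt s) then 0 else
    if r (mk s) < r (mk (rev s)) then 1 else -1, ?_, ?_, ?_, ?_⟩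
  · intro s
    simp only [edgeAt_turn, hturn, hrev]
  · intro s
    simp only [edgeAt_rev, rev_rev]
    by_cases hb : T.IsBdryEdge (T.edgeAt s)
    · simp [hb]
    · have hne : r (mk s) ≠ r (mk (rev s)) := fun h =>
        hb (T.isBdryEdge_of_sameCycle_rev
          (Quotient.exact (s := Equiv.Perm.SameCycle.setoid T.turn) (hr h)))
      rcases lt_or_gt_of_ne hne with h | h
      · simp [hb, h, h.not_gt]
      · simp [hb, h, h.not_gt]
  · intro s hs
    simp [hs]
  · intro s hs
    simp only [hs, if_false]
    split_ifs <;> simp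

end FaceGluing

/-! ### Counting the cells of the vertex links -/

namespace FaceGluing

open OrderedTet

variable {n : ℕ} (T : FaceGluing n)

instance : Finite T.Vertex := inferInstanceAs (Finite (Quot _))

instance : Finite T.DirectedEdge := inferInstanceAs (Finite (Quot _))

instance : Finite T.LinkArc := inferInstanceAs (Finite (Quot _))

/-- A corner keeps its vertex under a gluing of a face that contains it. -/
theorem vertexAt_eq_of_glue {i f j σ} (h : T.glue i f = some (j, σ)) {v : Fin 4} (hv : v ≠ f) :
    T.vertexAt j (σ v) = T.vertexAt i v :=
  (Quot.sound ⟨f, σ, hv, h, rfl⟩).symm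

/-- The vertex at which a directed edge starts. -/
def edgeStart : T.DirectedEdge → T.Vertex :=
  Quot.lift (fun p => T.vertexAt p.1.1 p.1.2.1) (by
    rintro p q ⟨f, σ, h1, -, h, h2, -⟩
    simp only [h2]
    exact (T.vertexAt_eq_of_glue h h1).symm)

/-- The vertex that an arc cuts off. -/
def arcStart : T.LinkArc → T.Vertex :=
  Quot.lift (fun p => T.vertexAt p.1.1 p.1.2.1) (by
    rintro p q ⟨σ, h, h2, -⟩
    simp only [h2]
    exact (T.vertexAt_eq_of_glue h p.2).symm)

theorem sum_ncard_fiber {α β : Type*} [Finite α] [Fintype β] (g : α → β) :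
    ∑ b, {a | g a = b}.ncard = Nat.card α := by
  classical
  have := Fintype.ofFinite α
  rw [Nat.card_eq_fintype_card, ← Finset.card_univ,
    Finset.card_eq_sum_card_fiberwise (f := g) (t := Finset.univ) (by simp)]
  refine Finset.sum_congr rfl fun b _ => ?_
  rw [← Set.ncard_coe_finset]
  simp

theorem linkZeroCells_eq (V : T.Vertex) : T.linkZeroCells V = {E | T.edgeStart E = V} := by
  ext E
  constructor
  · rintro ⟨p, rfl, h⟩
    exact h
  · intro h
    obtain ⟨p, rfl⟩ := Quot.exists_rep E
    exact ⟨p, rfl, h⟩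

theorem linkOneCells_eq (V : T.Vertex) : T.linkOneCells V = {A | T.arcStart A = V} := by
  ext E
  constructor
  · rintro ⟨p, rfl, h⟩
    exact h
  · intro h
    obtain ⟨p, rfl⟩ := Quot.exists_rep E
    exact ⟨p, rfl, h⟩

/-- The Euler characteristics of the links, summed over all vertices. -/
theorem card_cells (hT : T.IsThreeManifold) :
    Nat.card T.DirectedEdge + 4 * n =
      Nat.card T.LinkArc + Nat.card T.Vertex + Nat.card {V : T.Vertex // ¬ T.OnBoundary V} := by
  classical
  have := Fintype.ofFinite T.Vertex
  have h0 := sum_ncard_fiber T.edgeStart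
  have h1 := sum_ncard_fiber T.arcStart
  have h2 := sum_ncard_fiber (fun c : Fin n × Fin 4 => T.vertexAt c.1 c.2)
  -- A disc contributes 1 and a sphere 2, so each link counts once and the closed ones once more.
  have hs : ∑ V, T.linkEulerChar V =
      ∑ V : T.Vertex, ((1 : ℤ) + if ¬ T.OnBoundary V then 1 else 0) := by
    refine Finset.sum_congr rfl fun V _ => ?_
    rcases hT.2 V with ⟨h, h'⟩ | ⟨h, h'⟩ <;> simp [h, h']
  simp only [linkEulerChar, linkZeroCells_eq, linkOneCells_eq, linkTwoCells, Finset.sum_add_distrib,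
    Finset.sum_sub_distrib, Finset.sum_boole] at hs
  rw [Nat.card_eq_fintype_card (α := {V : T.Vertex // ¬ T.OnBoundary V}), Fintype.card_subtype]
  have hc : Nat.card (Fin n × Fin 4) = 4 * n := by
    simp [mul_comm]
  have hV : Nat.card T.Vertex = Fintype.card T.Vertex := Nat.card_eq_fintype_card
  simp only [← Nat.cast_sum, h0, h1, h2, hc] at hs
  simp only [Finset.sum_const, Finset.card_univ, mul_one, nsmul_eq_mul] at hs
  omega

theorem card_flag : Nat.card (Flag n) = 12 * n := by
  let e : Flag n ≃ Fin n × {p : Fin 4 × Fin 4 // p.1 ≠ p.2} :=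
    { toFun := fun p => (p.1.1, ⟨p.1.2, p.2⟩)
      invFun := fun p => ⟨(p.1, p.2.1), p.2.2⟩
      left_inv := fun _ => rfl
      right_inv := fun _ => rfl }
  have h : Fintype.card {p : Fin 4 × Fin 4 // p.1 ≠ p.2} = 12 := by decide
  rw [Nat.card_congr e, Nat.card_prod, Nat.card_eq_fintype_card (α := {p : Fin 4 × Fin 4 // _}), h]
  simp [mul_comm]

/-- An arc of a vertex link lies in at most two faces, and a boundary arc in only one. -/
theorem card_linkArc :
    12 * n + {p : Flag n | T.flagCross p = p}.ncard ≤ 2 * Nat.card T.LinkArc := by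
  classical
  have := Fintype.ofFinite T.LinkArc
  have h1 := sum_ncard_fiber T.linkArc
  have h2 := sum_ncard_fiber
    (fun p : {p : Flag n // T.flagCross p = p} => T.linkArc p)
  rw [card_flag] at h1
  have h3 : {p : Flag n | T.flagCross p = p}.ncard = Nat.card {p : Flag n // T.flagCross p = p} :=
    (Nat.card_coe_set_eq _).symm
  rw [h3, ← h1, ← h2, ← Finset.sum_add_distrib, Nat.card_eq_fintype_card, ← Finset.card_univ,
    mul_comm, ← smul_eq_mul, ← Finset.sum_const]
  refine Finset.sum_le_sum fun A _ => ?_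
  obtain ⟨p, rfl⟩ := Quot.exists_rep A
  change {a | T.linkArc a = T.linkArc p}.ncard + _ ≤ 2
  have hsub : {a | T.linkArc a = T.linkArc p} ⊆ {p, T.flagCross p} := by
    intro a ha
    exact (T.linkArc_eq_iff p a).1 (Eq.symm ha)
  by_cases hp : T.flagCross p = p
  · rw [hp] at hsub
    have ha : {a | T.linkArc a = T.linkArc p}.ncard ≤ 1 := by
      refine (Set.ncard_le_ncard hsub (Set.toFinite _)).trans ?_
      simp
    have hb : {a : {p : Flag n // T.flagCross p = p} | T.linkArc a = Quot.mk _ p}.ncard ≤ 1 := by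
      rw [Set.ncard_le_one (Set.toFinite _)]
      intro a ha b hb
      have ha' := hsub (show a.1 ∈ _ from ha)
      have hb' := hsub (show b.1 ∈ _ from hb)
      simp only [Set.pair_eq_singleton, Set.mem_singleton_iff] at ha' hb'
      exact Subtype.ext (ha'.trans hb'.symm)
    omega
  · have ha : {a | T.linkArc a = T.linkArc p}.ncard ≤ 2 :=
      (Set.ncard_le_ncard hsub (Set.toFinite _)).trans ((Set.ncard_insert_le _ _).trans (by simp))
    have hb : {a : {p : Flag n // T.flagCross p = p} | T.linkArc a = Quot.mk _ p} = ∅ := by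
      rw [Set.eq_empty_iff_forall_notMem]
      rintro ⟨a, hfix⟩ h
      rcases hsub (show a ∈ _ from h) with rfl | h
      · exact hp hfix
      · rw [Set.mem_singleton_iff] at h
        subst h
        rw [flagCross_flagCross] at hfix
        exact hp hfix.symm
    rw [hb, Set.ncard_empty]
    exact ha

/-- Around a boundary edge one meets boundary faces at both ends. -/
theorem two_le_card_fixed {E : T.DirectedEdge} (hE : T.IsBdryEdge E) :
    2 ≤ {s : OrderedTet n | T.edgeAt s = E ∧ T.cross s = s}.ncard := by
  classical
  obtain ⟨s, hs, hfix⟩ := hE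
  by_contra hlt
  have h1 : {s : OrderedTet n | T.edgeAt s = E ∧ T.cross s = s}.ncard ≤ 1 := by omega
  rw [Set.ncard_le_one (Set.toFinite _)] at h1
  let O : Finset (OrderedTet n) := Finset.univ.filter fun s => T.edgeAt s = E
  have hsO : s ∈ O := by simp [O, hs]
  -- Parity: `rev` has no fixed points, so `O` has even size. If `s` were the only fixed point of
  -- `cross` in `O`, then `cross` would pair off the rest and the size would be odd.
  have hO : ∑ t ∈ O, (1 : ZMod 2) = 0 := by
    refine Finset.sum_involution (fun t _ => rev t) (fun _ _ => by decide)
      (fun t _ _ => rev_ne_self t) (fun t ht => ?_) (fun t _ => rev_rev t)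
    simpa [O, edgeAt_rev] using ht
  have hO' : ∑ t ∈ O.erase s, (1 : ZMod 2) = 0 := by
    refine Finset.sum_involution (fun t _ => T.cross t) (fun _ _ => by decide)
      (fun t ht _ h => ?_) (fun t ht => ?_) (fun t _ => T.cross_cross t)
    · simp only [O, Finset.mem_erase, Finset.mem_filter, Finset.mem_univ, true_and] at ht
      exact ht.1 (h1 t ⟨ht.2, h⟩ s ⟨hs, hfix⟩)
    · simp only [O, Finset.mem_erase, Finset.mem_filter, Finset.mem_univ, true_and,
        edgeAt_cross] at ht ⊢
      refine ⟨fun h => ht.1 ?_, ht.2⟩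
      rw [← T.cross_cross t, h, hfix]
  rw [← Finset.add_sum_erase _ _ hsO, hO', add_zero] at hO
  exact absurd hO (by decide)

/-- The boundary of the links has at most as many 0-cells as arcs: at least two boundary arc ends
lie at each boundary 0-cell, and each arc has at most two ends. -/
theorem card_bdryEdge :
    Nat.card {E : T.DirectedEdge // T.IsBdryEdge E} ≤ {p : Flag n | T.flagCross p = p}.ncard := by
  classical
  have := Fintype.ofFinite T.DirectedEdge
  let X := {s : OrderedTet n // T.cross s = s}
  let Y := {p : Flag n // T.flagCross p = p}
  have hX : 2 * Nat.card {E : T.DirectedEdge // T.IsBdryEdge E} ≤ Nat.card X := by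
    rw [← sum_ncard_fiber (fun s : X =>
        (⟨T.edgeAt s, s, rfl, s.2⟩ : {E : T.DirectedEdge // T.IsBdryEdge E})),
      Nat.card_eq_fintype_card, ← Finset.card_univ, mul_comm, ← smul_eq_mul, ← Finset.sum_const]
    refine Finset.sum_le_sum fun E _ => (T.two_le_card_fixed E.2).trans ?_
    refine Set.ncard_le_ncard_of_injOn
      -- The second branch is a default value; only fixed `s` are counted.
      (fun s => if h : T.cross s = s then (⟨s, h⟩ : X) else
        ⟨E.2.choose, E.2.choose_spec.2⟩) ?_ ?_ (Set.toFinite _)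
    · rintro s ⟨hs, hs'⟩
      simp only [hs', dite_true, Set.mem_ofPred_eq]
      exact Subtype.ext hs
    · rintro s ⟨hs, hs'⟩ t ⟨ht, ht'⟩ h
      simp only [hs', ht', dite_true] at h
      exact congrArg Subtype.val h
  have hY : Nat.card X ≤ 2 * Nat.card Y := by
    rw [← sum_ncard_fiber (fun s : X => (⟨flag s.1, by rw [← flag_cross, s.2]⟩ : Y)),
      Nat.card_eq_fintype_card, ← Finset.card_univ, mul_comm, ← smul_eq_mul, ← Finset.sum_const]
    refine Finset.sum_le_sum fun p _ => ?_
    refine le_trans ?_ (card_flag_fiber p.1)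
    rw [← Set.ncard_coe_finset]
    refine Set.ncard_le_ncard_of_injOn (fun s => s.1) ?_ (fun s _ t _ h => Subtype.ext h)
      (Set.toFinite _)
    intro s hs
    simpa using congrArg Subtype.val hs
  have : Nat.card Y = {p : Flag n | T.flagCross p = p}.ncard := Nat.card_coe_set_eq _
  omega

end FaceGluing

/-! ### Vanishing of the first cohomology of the vertex links -/

/-- Pairwise orthogonal subspaces of large total dimension span everything. -/
theorem mem_of_orthogonal {ι : Type*} [Fintype ι] {U W Z : Submodule ℝ (ι → ℝ)}
    (hUW : ∀ u ∈ U, ∀ w ∈ W, u ⬝ᵥ w = 0) (hUZ : ∀ u ∈ U, ∀ z ∈ Z, u ⬝ᵥ z = 0)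
    (hWZ : ∀ w ∈ W, ∀ z ∈ Z, w ⬝ᵥ z = 0)
    (hdim : Fintype.card ι ≤
      Module.finrank ℝ U + Module.finrank ℝ W + Module.finrank ℝ Z)
    {g : ι → ℝ} (hgW : ∀ w ∈ W, g ⬝ᵥ w = 0) (hgZ : ∀ z ∈ Z, g ⬝ᵥ z = 0) : g ∈ U := by
  have disj : ∀ {A B : Submodule ℝ (ι → ℝ)}, (∀ a ∈ A, ∀ b ∈ B, a ⬝ᵥ b = 0) → Disjoint A B := by
    intro A B h
    rw [Submodule.disjoint_def]
    intro x hA hB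
    exact dotProduct_self_eq_zero.1 (h x hA x hB)
  have perp : ∀ x : ι → ℝ, (∀ w ∈ W, x ⬝ᵥ w = 0) → (∀ z ∈ Z, x ⬝ᵥ z = 0) →
      ∀ y ∈ W ⊔ Z, x ⬝ᵥ y = 0 := by
    intro x hW hZ y hy
    obtain ⟨w, hw, z, hz, rfl⟩ := Submodule.mem_sup.1 hy
    rw [dotProduct_add, hW w hw, hZ z hz, add_zero]
  have d1 := Submodule.finrank_sup_add_finrank_inf_eq W Z
  rw [(disj hWZ).eq_bot, finrank_bot] at d1
  have d2 := Submodule.finrank_sup_add_finrank_inf_eq U (W ⊔ Z)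
  rw [(disj fun u hu => perp u (hUW u hu) (hUZ u hu)).eq_bot, finrank_bot] at d2
  have htop : U ⊔ (W ⊔ Z) = ⊤ := by
    apply Submodule.eq_top_of_finrank_eq
    refine le_antisymm (Submodule.finrank_le _) ?_
    rw [Module.finrank_fintype_fun_eq_card]
    omega
  obtain ⟨u, hu, y, hy, rfl⟩ := Submodule.mem_sup.1 (htop ▸ Submodule.mem_top : g ∈ U ⊔ (W ⊔ Z))
  -- Both `u + y` and `u` are orthogonal to `y`, so `y` is orthogonal to itself and vanishes.
  have hy0 := perp _ hgW hgZ y hy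
  rw [add_dotProduct, perp u (hUW u hu) (hUZ u hu) y hy, zero_add] at hy0
  rw [dotProduct_self_eq_zero.1 hy0, add_zero]
  exact hu

/-- The corner that an arc cuts off. -/
def Flag.corner {n : ℕ} (p : Flag n) : Fin n × Fin 4 := (p.1.1, p.1.2.1)

namespace FaceGluing

open OrderedTet

variable {n : ℕ} (T : FaceGluing n)

/-- A choice of direction around each edge, with opposite signs at opposite directions. -/
noncomputable def sign : OrderedTet n → ℝ := T.exists_sign.choose

theorem sign_turn (s : OrderedTet n) : T.sign (T.turn s) = T.sign s :=
  T.exists_sign.choose_spec.1 s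

theorem sign_rev (s : OrderedTet n) : T.sign (rev s) = -T.sign s :=
  T.exists_sign.choose_spec.2.1 s

theorem sign_eq_zero {s : OrderedTet n} (h : T.IsBdryEdge (T.edgeAt s)) : T.sign s = 0 :=
  T.exists_sign.choose_spec.2.2.1 s h

theorem abs_sign {s : OrderedTet n} (h : ¬ T.IsBdryEdge (T.edgeAt s)) : |T.sign s| = 1 :=
  T.exists_sign.choose_spec.2.2.2 s h

theorem sign_cross (s : OrderedTet n) : T.sign (T.cross s) = -T.sign s := by
  rw [cross_eq_rev_turn, sign_rev, sign_turn]

/-- The coboundary of a function on the triangles of the vertex links, evaluated at arcs. -/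
def cornerCob : (Fin n × Fin 4 → ℝ) →ₗ[ℝ] (Flag n → ℝ) where
  toFun w p := w p.corner - w (T.flagCross p).corner
  map_add' _ _ := by ext; simp only [Pi.add_apply]; ring
  map_smul' _ _ := by ext; simp only [Pi.smul_apply, smul_eq_mul, RingHom.id_apply]; ring

/-- The dual coboundary of a function on the 0-cells of the vertex links. -/
noncomputable def edgeCob : (T.DirectedEdge → ℝ) →ₗ[ℝ] (Flag n → ℝ) where
  toFun h p := ∑ s : OrderedTet n with flag s = p, h (T.edgeAt s) * T.sign s
  map_add' _ _ := by
    ext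
    simp only [Pi.add_apply, add_mul, Finset.sum_add_distrib]
  map_smul' _ _ := by
    ext
    simp only [Pi.smul_apply, smul_eq_mul, RingHom.id_apply, mul_assoc, Finset.mul_sum]

/-- Functions on the 1-cells of the vertex links. -/
def arcFun : (T.LinkArc → ℝ) →ₗ[ℝ] (Flag n → ℝ) := LinearMap.funLeft ℝ ℝ T.linkArc

theorem cornerCob_apply (w : Fin n × Fin 4 → ℝ) (p : Flag n) :
    T.cornerCob w p = w p.corner - w (T.flagCross p).corner := rfl

theorem edgeCob_apply (h : T.DirectedEdge → ℝ) (p : Flag n) :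
    T.edgeCob h p = ∑ s : OrderedTet n with flag s = p, h (T.edgeAt s) * T.sign s := rfl

theorem arcFun_apply (k : T.LinkArc → ℝ) (p : Flag n) : T.arcFun k p = k (T.linkArc p) := rfl

/-- Regrouped by ordered tetrahedra, the pairing is a combination of the circulations of `g` around
the 0-cells, weighted by `h`. Boundary 0-cells drop out because their sign is 0. -/
theorem dotProduct_edgeCob (g : Flag n → ℝ) (h : T.DirectedEdge → ℝ) :
    g ⬝ᵥ T.edgeCob h = ∑ s : OrderedTet n, g (flag s) * (h (T.edgeAt s) * T.sign s) := by
  rw [← Finset.sum_fiberwise (s := Finset.univ) (g := flag)]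
  refine Finset.sum_congr rfl fun p _ => ?_
  rw [edgeCob_apply, Finset.mul_sum]
  refine Finset.sum_congr rfl fun s hs => ?_
  rw [(Finset.mem_filter.1 hs).2]

theorem dotProduct_arcFun_of_antisymm {g : Flag n → ℝ} (hg : ∀ p, g (T.flagCross p) = -g p)
    (k : T.LinkArc → ℝ) : g ⬝ᵥ T.arcFun k = 0 := by
  have h : g ⬝ᵥ T.arcFun k = -(g ⬝ᵥ T.arcFun k) := by
    conv_lhs => rw [dotProduct, ← Equiv.sum_comp T.flagCross]
    rw [dotProduct, ← Finset.sum_neg_distrib]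
    refine Finset.sum_congr rfl fun p _ => ?_
    rw [hg, arcFun_apply, linkArc_flagCross, arcFun_apply, neg_mul]
  linarith

theorem cornerCob_antisymm (w : Fin n × Fin 4 → ℝ) (p : Flag n) :
    T.cornerCob w (T.flagCross p) = -T.cornerCob w p := by
  simp only [cornerCob_apply, flagCross_flagCross]
  ring

theorem edgeCob_dotProduct_arcFun (h : T.DirectedEdge → ℝ) (k : T.LinkArc → ℝ) :
    T.edgeCob h ⬝ᵥ T.arcFun k = 0 := by
  rw [dotProduct_comm, dotProduct_edgeCob]
  set S := ∑ s : OrderedTet n, T.arcFun k (flag s) * (h (T.edgeAt s) * T.sign s) with hS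
  have : S = -S := by
    conv_lhs => rw [hS, ← Equiv.sum_comp T.cross]
    rw [hS, ← Finset.sum_neg_distrib]
    refine Finset.sum_congr rfl fun p _ => ?_
    rw [flag_cross, arcFun_apply, linkArc_flagCross, arcFun_apply, sign_cross, edgeAt_cross]
    ring
  linarith

theorem corner_flag_rev (s : OrderedTet n) : (flag (rev s)).corner = (flag s).corner := by
  simp [flag, Flag.corner, rev_apply, Equiv.swap_apply_def]

theorem corner_flag_cross (s : OrderedTet n) :
    (flag (T.cross s)).corner = (flag (T.turn s)).corner := by
  rw [cross_eq_rev_turn, corner_flag_rev]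

/-- A coboundary telescopes around a 0-cell: the corner behind a crossed arc is the one from which
the next turn starts, and signs and edges are constant under `turn`. -/
theorem cornerCob_dotProduct_edgeCob (w : Fin n × Fin 4 → ℝ) (h : T.DirectedEdge → ℝ) :
    T.cornerCob w ⬝ᵥ T.edgeCob h = 0 := by
  rw [dotProduct_edgeCob]
  simp only [cornerCob_apply, sub_mul, Finset.sum_sub_distrib, ← flag_cross, corner_flag_cross]
  rw [sub_eq_zero]
  conv_lhs => rw [← Equiv.sum_comp T.turn]
  simp only [sign_turn, edgeAt_turn]

/-- Functions on ordered tetrahedra that are constant around the vertex links. -/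
theorem exists_vertex_function {α : Type*} (a : OrderedTet n → α)
    (h1 : ∀ s : OrderedTet n, a (s.1, s.2 * Equiv.swap 1 2) = a s)
    (h2 : ∀ s, a (rev s) = a s) (h3 : ∀ s, a (T.cross s) = a s) :
    ∃ m : T.Vertex → α, ∀ s, a s = m (T.vertexAt s.1 (s.2 0)) := by
  -- The permutations fixing `0` are words in the two transpositions under which `a` is invariant,
  -- so `a` depends only on the corner.
  have hgen : ∀ u : Equiv.Perm (Fin 4), u 0 = 0 →
      u = 1 ∨ u = Equiv.swap 1 2 ∨ u = Equiv.swap 2 3 ∨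
      u = Equiv.swap 1 2 * Equiv.swap 2 3 ∨ u = Equiv.swap 2 3 * Equiv.swap 1 2 ∨
      u = Equiv.swap 1 2 * Equiv.swap 2 3 * Equiv.swap 1 2 := by decide
  have h1' : ∀ i p, a (i, p * Equiv.swap 1 2) = a (i, p) := fun i p => h1 (i, p)
  have h2' : ∀ i p, a (i, p * Equiv.swap 2 3) = a (i, p) := fun i p => h2 (i, p)
  have hcorner : ∀ i (p p' : Equiv.Perm (Fin 4)), p 0 = p' 0 → a (i, p') = a (i, p) := by
    intro i p p' h
    have hp : p' = p * (p⁻¹ * p') := by simp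
    rw [hp]
    rcases hgen (p⁻¹ * p') (by simp [← h]) with e | e | e | e | e | e <;> rw [e] <;>
      simp only [← mul_assoc, h1', h2', mul_one]
  let c : Fin n × Fin 4 → α := fun q => a (q.1, Equiv.swap 0 q.2)
  have hc : ∀ s : OrderedTet n, a s = c (s.1, s.2 0) := fun s => hcorner _ _ _ (by simp)
  refine ⟨Quot.lift c ?_, hc⟩
  rintro ⟨i, v⟩ ⟨j, v'⟩ ⟨f, σ, hv, hg, rfl⟩
  obtain ⟨b, hb, hb'⟩ : ∃ b : Fin 4, v ≠ b ∧ b ≠ f :=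
    (by decide : ∀ v f : Fin 4, ∃ b : Fin 4, v ≠ b ∧ b ≠ f) v f
  obtain ⟨s, rfl, rfl, -, rfl⟩ := exists_edge i hb hv hb'
  have hs := h3 s
  rw [cross_apply, crossFun_some hg] at hs
  exact (hc s).symm.trans (hs.symm.trans (hc _))

theorem filter_flag_eq (s : OrderedTet n) :
    (Finset.univ.filter fun t : OrderedTet n => flag t = flag s) =
      {s, (s.1, s.2 * Equiv.swap 1 2)} := by
  symm
  apply Finset.eq_of_subset_of_card_le
  · intro t ht
    simp only [Finset.mem_insert, Finset.mem_singleton] at ht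
    rcases ht with rfl | rfl
    · simp
    · simp [flag, Equiv.swap_apply_def]
  · refine (card_flag_fiber _).trans ?_
    rw [Finset.card_pair]
    intro h
    have := congrArg (fun t : OrderedTet n => t.2 1) h
    simp at this

/-- At each arc only its two ends contribute, so their signed values are opposite. Absolute values
remove the signs, and no coherent orientation of the link is needed. -/
theorem abs_eq_of_edgeCob_eq_zero {h : T.DirectedEdge → ℝ} (hh : T.edgeCob h = 0) :
    ∃ m : T.Vertex → ℝ, ∀ s, |h (T.edgeAt s) * T.sign s| = m (T.vertexAt s.1 (s.2 0)) := by
  apply T.exists_vertex_function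
  · intro s
    have h0 := congrFun hh (flag s)
    rw [edgeCob_apply, filter_flag_eq, Finset.sum_pair, Pi.zero_apply] at h0
    · rw [eq_neg_of_add_eq_zero_right h0, abs_neg]
    · intro h
      have := congrArg (fun t : OrderedTet n => t.2 1) h
      simp at this
  · intro s
    rw [edgeAt_rev, sign_rev, mul_neg, abs_neg]
  · intro s
    rw [edgeAt_cross, sign_cross, mul_neg, abs_neg]

theorem exists_edgeStart (V : T.Vertex) : ∃ s : OrderedTet n, T.vertexAt s.1 (s.2 0) = V := by
  obtain ⟨⟨i, v⟩, rfl⟩ := Quot.exists_rep V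
  exact ⟨(i, Equiv.swap 0 v), congrArg (T.vertexAt i) (by simp)⟩

/-- On each link a kernel element has constant absolute value away from the boundary 0-cells. The
constant is 0 if the link has boundary, where the sign vanishes; otherwise one 0-cell determines it.
The values at boundary edges are free and are counted separately. -/
theorem finrank_ker_edgeCob_le : Module.finrank ℝ (LinearMap.ker T.edgeCob) ≤
    Nat.card {V : T.Vertex // ¬ T.OnBoundary V} +
      Nat.card {E : T.DirectedEdge // T.IsBdryEdge E} := by
  classical
  have := Fintype.ofFinite T.Vertex
  have := Fintype.ofFinite T.DirectedEdge
  choose base hbase using T.exists_edgeStart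
  let φ : (T.DirectedEdge → ℝ) →ₗ[ℝ] ({V : T.Vertex // ¬ T.OnBoundary V} → ℝ) ×
      ({E : T.DirectedEdge // T.IsBdryEdge E} → ℝ) :=
    LinearMap.prod (LinearMap.funLeft ℝ ℝ fun V => T.edgeAt (base V.1))
      (LinearMap.funLeft ℝ ℝ fun E => E.1)
  have hφ : Function.Injective (φ.comp (LinearMap.ker T.edgeCob).subtype) := by
    rw [injective_iff_map_eq_zero]
    rintro ⟨h, hh⟩ h0
    obtain ⟨m, hm⟩ := T.abs_eq_of_edgeCob_eq_zero hh
    have hV : ∀ V : {V : T.Vertex // ¬ T.OnBoundary V}, h (T.edgeAt (base V.1)) = 0 := fun V =>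
      congrFun (congrArg Prod.fst h0) V
    have hE : ∀ E : {E : T.DirectedEdge // T.IsBdryEdge E}, h E.1 = 0 := fun E =>
      congrFun (congrArg Prod.snd h0) E
    have hm0 : ∀ V, m V = 0 := by
      intro V
      by_cases hb : T.OnBoundary V
      · obtain ⟨i, v, f, hvf, rfl, hg⟩ := hb
        obtain ⟨b, hb, hb'⟩ : ∃ b : Fin 4, v ≠ b ∧ b ≠ f :=
          (by decide : ∀ v f : Fin 4, ∃ b : Fin 4, v ≠ b ∧ b ≠ f) v f
        obtain ⟨s, rfl, rfl, -, rfl⟩ := exists_edge i hb hvf hb'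
        rw [← hm, T.sign_eq_zero ⟨s, rfl, (T.cross_eq_self_iff s).2 hg⟩, mul_zero, abs_zero]
      · rw [← hbase V, ← hm, hV ⟨V, hb⟩, zero_mul, abs_zero]
    apply Subtype.ext
    funext E
    by_cases hb : T.IsBdryEdge E
    · exact hE ⟨E, hb⟩
    · obtain ⟨⟨⟨i, v, b⟩, hvb⟩, rfl⟩ := Quot.exists_rep E
      obtain ⟨f, hf, hf'⟩ : ∃ f : Fin 4, v ≠ f ∧ b ≠ f :=
        (by decide : ∀ v b : Fin 4, ∃ f : Fin 4, v ≠ f ∧ b ≠ f) v b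
      obtain ⟨s, rfl, rfl, rfl, -⟩ := exists_edge i hvb hf hf'
      have := hm s
      rw [hm0, abs_mul, T.abs_sign hb, mul_one, abs_eq_zero] at this
      exact this
  have := LinearMap.finrank_le_finrank_of_injective hφ
  rw [Module.finrank_prod, Module.finrank_fintype_fun_eq_card,
    Module.finrank_fintype_fun_eq_card] at this
  rwa [Nat.card_eq_fintype_card, Nat.card_eq_fintype_card]

theorem corner_flagCross_of_glue {i f j σ} (hg : T.glue i f = some (j, σ)) {v : Fin 4}
    (hv : v ≠ f) : (T.flagCross ⟨(i, v, f), hv⟩).corner = (j, σ v) := by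
  rw [flagCross_apply, flagCrossFun_some (p := ⟨(i, v, f), hv⟩) hg]
  rfl

theorem eq_of_cornerCob_eq_zero {w : Fin n × Fin 4 → ℝ} (hw : T.cornerCob w = 0) :
    ∃ m : T.Vertex → ℝ, ∀ i v, w (i, v) = m (T.vertexAt i v) := by
  refine ⟨Quot.lift w ?_, fun _ _ => rfl⟩
  rintro ⟨i, v⟩ ⟨j, v'⟩ ⟨f, σ, hv, hg, rfl⟩
  have h := congrFun hw ⟨(i, v, f), hv⟩
  rw [cornerCob_apply, T.corner_flagCross_of_glue hg hv] at h
  exact sub_eq_zero.1 h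

theorem finrank_ker_cornerCob_le :
    Module.finrank ℝ (LinearMap.ker T.cornerCob) ≤ Nat.card T.Vertex := by
  classical
  have := Fintype.ofFinite T.Vertex
  choose base hbase using T.exists_edgeStart
  let φ : (Fin n × Fin 4 → ℝ) →ₗ[ℝ] (T.Vertex → ℝ) :=
    LinearMap.funLeft ℝ ℝ fun V => ((base V).1, (base V).2 0)
  have hφ : Function.Injective (φ.comp (LinearMap.ker T.cornerCob).subtype) := by
    rw [injective_iff_map_eq_zero]
    rintro ⟨w, hw⟩ h0
    obtain ⟨m, hm⟩ := T.eq_of_cornerCob_eq_zero hw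
    have hm0 : ∀ V, m V = 0 := by
      intro V
      rw [← hbase V, ← hm]
      exact congrFun h0 V
    apply Subtype.ext
    funext ⟨i, v⟩
    exact (hm i v).trans (hm0 _)
  have := LinearMap.finrank_le_finrank_of_injective hφ
  rwa [Module.finrank_fintype_fun_eq_card, ← Nat.card_eq_fintype_card] at this

theorem arcFun_injective : Function.Injective T.arcFun :=
  LinearMap.funLeft_injective_of_surjective _ _ _ Quot.mk_surjective

/-- The first cohomology of the vertex links vanishes: they are spheres and discs. -/
theorem mem_range_cornerCob (hT : T.IsThreeManifold) {g : Flag n → ℝ}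
    (hg : ∀ p, g (T.flagCross p) = -g p)
    (hcyc : ∀ h : T.DirectedEdge → ℝ, g ⬝ᵥ T.edgeCob h = 0) :
    ∃ w, T.cornerCob w = g := by
  classical
  have := Fintype.ofFinite T.Vertex
  have := Fintype.ofFinite T.DirectedEdge
  have := Fintype.ofFinite T.LinkArc
  refine mem_of_orthogonal (U := LinearMap.range T.cornerCob) (W := LinearMap.range T.edgeCob)
    (Z := LinearMap.range T.arcFun) ?_ ?_ ?_ ?_ ?_ ?_
  · rintro _ ⟨w, rfl⟩ _ ⟨h, rfl⟩
    exact T.cornerCob_dotProduct_edgeCob w h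
  · rintro _ ⟨w, rfl⟩ _ ⟨k, rfl⟩
    exact T.dotProduct_arcFun_of_antisymm (T.cornerCob_antisymm w) k
  · rintro _ ⟨h, rfl⟩ _ ⟨k, rfl⟩
    exact T.edgeCob_dotProduct_arcFun h k
  -- Let `E`, `A`, `V` count directed edges, link arcs and vertices, `V'` the vertices off the
  -- boundary, `E'` the boundary edges and `b` the boundary arcs. The ranks add up to at least `(4n
  -- - V) + (E - V' - E') + A`. This is at least `12n`, since `E + 4n = A + V + V'`, `12n + b ≤ 2A`
  -- and `E' ≤ b`.
  · have r1 := LinearMap.finrank_range_add_finrank_ker T.cornerCob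
    have r2 := LinearMap.finrank_range_add_finrank_ker T.edgeCob
    have r3 := LinearMap.finrank_range_of_inj T.arcFun_injective
    rw [Module.finrank_fintype_fun_eq_card, ← Nat.card_eq_fintype_card] at r1 r2 r3
    have k1 := T.finrank_ker_cornerCob_le
    have k2 := T.finrank_ker_edgeCob_le
    have c1 := T.card_cells hT
    have c2 := T.card_linkArc
    have c3 := T.card_bdryEdge
    have c4 : Nat.card (Fin n × Fin 4) = 4 * n := by simp [mul_comm]
    rw [← Nat.card_eq_fintype_card, card_flag]
    omega
  · rintro _ ⟨h, rfl⟩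
    exact hcyc h
  · rintro _ ⟨k, rfl⟩
    exact T.dotProduct_arcFun_of_antisymm hg k

end FaceGluing

/-! ### Matching equations as cochain equations, and canonical extensions -/

namespace FaceGluing

open OrderedTet

variable {n : ℕ} (T : FaceGluing n)

theorem turnStep_iff (s t : OrderedTet n) :
    T.TurnStep s t ↔ T.glue s.1 (s.2 3) ≠ none ∧ T.turn s = t := by
  constructor
  · rintro ⟨σ, h, h'⟩
    refine ⟨by simp [h], ?_⟩
    rw [turn_apply, cross_apply, crossFun_some h, rev_apply]
    exact Prod.ext rfl h'.symm
  · rintro ⟨h, rfl⟩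
    rcases h' : T.glue s.1 (s.2 3) with _ | ⟨j, σ⟩
    · exact absurd h' h
    · rw [turn_apply, cross_apply, crossFun_some h', rev_apply]
      exact ⟨σ, h', rfl⟩

theorem sameCycle_of_around {s t : OrderedTet n} (h : T.Around s t) : T.turn.SameCycle s t := by
  induction h with
  | refl => exact .refl _ _
  | tail _ h ih =>
    rw [← ((T.turnStep_iff _ _).1 h).2, Equiv.Perm.sameCycle_apply_right]
    exact ih

-- At a non-boundary edge each `turn` met is a genuine `TurnStep`. By finiteness, non-negative
-- powers already exhaust the cycle, so no backward steps are needed.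
variable {T} in
theorem NonBoundaryEdge.around_iff {s : OrderedTet n} (hs : T.NonBoundaryEdge s)
    (t : OrderedTet n) : T.Around s t ↔ T.turn.SameCycle s t := by
  refine ⟨T.sameCycle_of_around, fun h => ?_⟩
  obtain ⟨k, -, rfl⟩ := h.exists_pow_eq'
  induction k with
  | zero => exact .refl
  | succ k ih =>
    have ih' := ih ⟨k, by simp⟩
    refine Relation.ReflTransGen.tail ih' ((T.turnStep_iff _ _).2 ⟨hs _ ih', ?_⟩)
    rw [pow_succ', Equiv.Perm.mul_apply]

theorem nonBoundaryEdge_of_not_isBdryEdge {s : OrderedTet n}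
    (h : ¬ T.IsBdryEdge (T.edgeAt s)) : T.NonBoundaryEdge s := fun t ht hg =>
  h ⟨t, (T.edgeAt_eq_of_sameCycle (T.sameCycle_of_around ht)).symm,
    (T.cross_eq_self_iff t).2 hg⟩

/-- The number of quadrilaterals that have an arc parallel to the given one. -/
def quadArc (q : QuadVec n) (p : Flag n) : ℝ := q (p.1.1, quadType p.1.2.1 p.1.2.2)

/-- The difference of the numbers of quadrilaterals at the two sides of an arc. -/
def quadDiff (q : QuadVec n) (p : Flag n) : ℝ := quadArc q (T.flagCross p) - quadArc q p

theorem quadDiff_antisymm (q : QuadVec n) (p : Flag n) :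
    T.quadDiff q (T.flagCross p) = -T.quadDiff q p := by
  simp [quadDiff, flagCross_flagCross]

/-- The triangular coordinates. -/
def triPart (w : StdVec n) : Fin n × Fin 4 → ℝ := fun c => w (c.1, Sum.inl c.2)

/-- For a given quadrilateral part this is an inhomogeneous coboundary equation for the triangle
coordinates. At a boundary arc `flagCross` is the identity and both sides vanish. -/
theorem stdMatching_iff (w : StdVec n) :
    T.StdMatching w ↔ T.cornerCob (triPart w) = T.quadDiff (quadProj w) := by
  constructor
  · intro h
    funext ⟨⟨i, v, f⟩, hv⟩
    rw [cornerCob_apply, quadDiff]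
    rcases hg : T.glue i f with _ | ⟨j, σ⟩
    · rw [flagCross_apply, flagCrossFun_none (p := ⟨(i, v, f), hv⟩) hg]
      ring
    · rw [flagCross_apply, flagCrossFun_some (p := ⟨(i, v, f), hv⟩) hg]
      have := h i f j σ hg v hv
      simp only [quadArc, triPart, Flag.corner, quadProj]
      linarith
  · intro h i f j σ hg v hv
    have h' := congrFun h ⟨(i, v, f), hv⟩
    rw [cornerCob_apply, quadDiff, flagCross_apply,
      flagCrossFun_some (p := ⟨(i, v, f), hv⟩) hg] at h'
    simp only [quadArc, triPart, Flag.corner, quadProj] at h'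
    linarith

theorem sum_sameCycle_turn (s : OrderedTet n) [DecidablePred (T.turn.SameCycle s)]
    (f : OrderedTet n → ℝ) :
    ∑ t with T.turn.SameCycle s t, f (T.turn t) = ∑ t with T.turn.SameCycle s t, f t :=
  Finset.sum_equiv T.turn (by simp [Equiv.Perm.sameCycle_apply_right]) fun _ _ => rfl

theorem quadArc_flag_rev (q : QuadVec n) (s : OrderedTet n) :
    quadArc q (flag (rev s)) = q (s.1, quadType (s.2 0) (s.2 2)) := by
  simp [quadArc, flag, rev_apply, Equiv.swap_apply_def]

-- Reindexing by `turn` moves the far side of each exit face to the entrance face of the next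
-- tetrahedron, where the upward quadrilaterals are counted.
open Classical in
theorem sum_quadDiff (q : QuadVec n) (s : OrderedTet n) :
    ∑ t with T.turn.SameCycle s t, T.quadDiff q (flag t) =
      ∑ t : OrderedTet n with T.turn.SameCycle s t, q (t.1, quadType (t.2 0) (t.2 2)) -
      ∑ t : OrderedTet n with T.turn.SameCycle s t, q (t.1, quadType (t.2 0) (t.2 3)) := by
  simp only [quadDiff, Finset.sum_sub_distrib, ← flag_cross, cross_eq_rev_turn]
  congr 1
  rw [T.sum_sameCycle_turn s fun t => quadArc q (flag (rev t))]
  exact Finset.sum_congr rfl fun t _ => quadArc_flag_rev q t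

open Classical in
theorem quadMatching_iff (q : QuadVec n) :
    T.QuadMatching q ↔ ∀ s, T.NonBoundaryEdge s →
      ∑ t with T.turn.SameCycle s t, T.quadDiff q (flag t) = 0 := by
  refine forall₂_congr fun s hs => ?_
  rw [sum_quadDiff, sub_eq_zero]
  have : (Finset.univ.filter fun t => T.Around s t) =
      Finset.univ.filter fun t => T.turn.SameCycle s t :=
    Finset.filter_congr fun t _ => hs.around_iff t
  rw [this]

/-- The quadrilateral matching equations follow from the standard ones. -/
theorem StdMatching.quadMatching {w : StdVec n} (hw : T.StdMatching w) :
    T.QuadMatching (quadProj w) := by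
  classical
  rw [quadMatching_iff]
  intro s _
  rw [← (T.stdMatching_iff w).1 hw]
  simp only [cornerCob_apply, Finset.sum_sub_distrib, ← flag_cross, corner_flag_cross]
  rw [sub_eq_zero]
  exact (T.sum_sameCycle_turn s fun t => triPart w (flag t).corner).symm

-- The pairing splits over the cycles of `turn`, on which edge and sign are constant. Each part is a
-- multiple of one quadrilateral matching equation, or has sign 0 at a boundary edge.
open Classical in
theorem quadDiff_dotProduct_edgeCob {q : QuadVec n} (hq : T.QuadMatching q)
    (h : T.DirectedEdge → ℝ) : T.quadDiff q ⬝ᵥ T.edgeCob h = 0 := by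
  rw [dotProduct_edgeCob]
  let Q := Quotient (Equiv.Perm.SameCycle.setoid T.turn)
  let mk : OrderedTet n → Q := Quotient.mk _
  have : Fintype Q := Fintype.ofFinite Q
  rw [← Finset.sum_fiberwise (s := Finset.univ) (g := mk)]
  refine Finset.sum_eq_zero fun c _ => ?_
  obtain ⟨s, rfl⟩ := Quotient.exists_rep c
  have hmk : ∀ t, mk t = mk s ↔ T.turn.SameCycle s t := fun t =>
    (Quotient.eq (r := Equiv.Perm.SameCycle.setoid T.turn)).trans
      ⟨fun h => Equiv.Perm.SameCycle.symm h, fun h => Equiv.Perm.SameCycle.symm h⟩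
  have hsign : ∀ t, T.turn.SameCycle s t → T.sign t = T.sign s := by
    rintro _ ⟨k, rfl⟩
    induction k with
    | zero => rfl
    | succ k ih => rw [add_comm, zpow_add, zpow_one, Equiv.Perm.mul_apply, sign_turn, ih]
    | pred k ih =>
      rw [sub_eq_neg_add, zpow_add, zpow_neg_one, Equiv.Perm.mul_apply, ← T.sign_turn]
      simpa using ih
  have hsum : ∑ t with mk t = mk s, T.quadDiff q (flag t) * (h (T.edgeAt t) * T.sign t) =
      (∑ t with T.turn.SameCycle s t, T.quadDiff q (flag t)) * (h (T.edgeAt s) * T.sign s) := by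
    rw [Finset.sum_mul]
    refine Finset.sum_congr (Finset.filter_congr fun t _ => hmk t) fun t ht => ?_
    have ht' := (Finset.mem_filter.1 ht).2
    rw [hsign t ht', T.edgeAt_eq_of_sameCycle ht']
  refine hsum.trans ?_
  by_cases hb : T.IsBdryEdge (T.edgeAt s)
  · rw [T.sign_eq_zero hb, mul_zero, mul_zero]
  · rw [(T.quadMatching_iff q).1 hq s (T.nonBoundaryEdge_of_not_isBdryEdge hb), zero_mul]

/-- Every solution of the quadrilateral matching equations extends to a solution of the standard
matching equations. -/
theorem QuadMatching.exists_stdMatching (hT : T.IsThreeManifold) {q : QuadVec n}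
    (hq : T.QuadMatching q) : ∃ w : StdVec n, T.StdMatching w ∧ quadProj w = q := by
  obtain ⟨t, ht⟩ := T.mem_range_cornerCob hT (T.quadDiff_antisymm q)
    (T.quadDiff_dotProduct_edgeCob hq)
  refine ⟨fun c => Sum.elim (fun v => t (c.1, v)) (fun k => q (c.1, k)) c.2, ?_, rfl⟩
  rw [stdMatching_iff]
  exact ht

/-- Solutions of the standard matching equations without quadrilaterals are combinations of vertex
links. -/
theorem StdMatching.exists_vertex_function {w : StdVec n} (hw : T.StdMatching w)
    (hq : quadProj w = 0) : ∃ m : T.Vertex → ℝ, ∀ i v, w (i, Sum.inl v) = m (T.vertexAt i v) := by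
  apply T.eq_of_cornerCob_eq_zero (w := triPart w)
  rw [(T.stdMatching_iff w).1 hw, hq]
  funext p
  simp [quadDiff, quadArc]

variable {T} in
theorem StdMatching.add_smul {w w' : StdVec n} (h : T.StdMatching w) (h' : T.StdMatching w')
    (a : ℝ) : T.StdMatching (w + a • w') := by
  intro i f j σ hg v hv
  have e := h i f j σ hg v hv
  have e' := h' i f j σ hg v hv
  simp only [Pi.add_apply, Pi.smul_apply, smul_eq_mul]
  linear_combination e + a * e'

/-- The largest multiple of a vertex link that can be subtracted is the minimum of the triangle
coordinates around that vertex. -/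
theorem isCanonical_iff (w : StdVec n) : T.IsCanonical w ↔
    (∀ i v, 0 ≤ w (i, Sum.inl v)) ∧
      ∀ V, ∃ i v, T.vertexAt i v = V ∧ w (i, Sum.inl v) = 0 := by
  classical
  refine and_congr_right fun hw => forall_congr' fun V => ⟨fun h => ?_, ?_⟩
  · by_contra! hne
    obtain ⟨s, hs⟩ := T.exists_edgeStart V
    let X := Finset.univ.filter fun c : Fin n × Fin 4 => T.vertexAt c.1 c.2 = V
    obtain ⟨c, hc, hmin⟩ := X.exists_min_image (fun c => w (c.1, Sum.inl c.2))
      ⟨(s.1, s.2 0), by simp [X, hs]⟩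
    have hc' : T.vertexAt c.1 c.2 = V := (Finset.mem_filter.1 hc).2
    obtain ⟨i, v, hlt⟩ := h (w (c.1, Sum.inl c.2))
      (lt_of_le_of_ne (hw _ _) (hne _ _ hc').symm)
    simp only [Pi.sub_apply, Pi.smul_apply, vertexLink, smul_eq_mul] at hlt
    split_ifs at hlt with hV
    · have := hmin (i, v) (by simp [X, hV])
      simp only at this
      linarith
    · have := hw i v
      linarith
  · rintro ⟨i, v, hV, h0⟩ ε hε
    refine ⟨i, v, ?_⟩
    simp [vertexLink, hV, h0, hε]

/-- Canonical extensions exist. -/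
theorem exists_isCanonicalExtension (hT : T.IsThreeManifold) {q : QuadVec n}
    (h0 : ∀ c, 0 ≤ q c) (hq : T.QuadMatching q) (hc : QuadConstraints q) :
    ∃ x, T.IsCanonicalExtension q x := by
  classical
  obtain ⟨w, hw, rfl⟩ := QuadMatching.exists_stdMatching T hT hq
  have hmin : ∀ V : T.Vertex, ∃ c : Fin n × Fin 4, T.vertexAt c.1 c.2 = V ∧
      ∀ i v, T.vertexAt i v = V → w (c.1, Sum.inl c.2) ≤ w (i, Sum.inl v) := by
    intro V
    obtain ⟨s, hs⟩ := T.exists_edgeStart V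
    let X := Finset.univ.filter fun c : Fin n × Fin 4 => T.vertexAt c.1 c.2 = V
    obtain ⟨c, hc, hmin⟩ := X.exists_min_image (fun c => w (c.1, Sum.inl c.2))
      ⟨(s.1, s.2 0), by simp [X, hs]⟩
    exact ⟨c, (Finset.mem_filter.1 hc).2, fun i v hv => hmin (i, v) (by simp [X, hv])⟩
  choose c hcV hcmin using hmin
  -- The subtracted minima are constant around each vertex, so they cancel in every matching
  -- equation.
  let x : StdVec n := fun d => Sum.elim
    (fun v => w (d.1, Sum.inl v) -
      w ((c (T.vertexAt d.1 v)).1, Sum.inl (c (T.vertexAt d.1 v)).2))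
    (fun k => w (d.1, Sum.inr k)) d.2
  have hx : ∀ i v, x (i, Sum.inl v) = w (i, Sum.inl v) -
      w ((c (T.vertexAt i v)).1, Sum.inl (c (T.vertexAt i v)).2) := fun _ _ => rfl
  have hxq : quadProj x = quadProj w := rfl
  have hxt : ∀ i v, 0 ≤ x (i, Sum.inl v) := fun i v => by
    rw [hx]
    have := hcmin _ i v rfl
    linarith
  refine ⟨x, ⟨?_, ?_, hc⟩, ?_, hxq⟩
  · rintro ⟨i, v | k⟩
    · exact hxt i v
    · exact h0 (i, k)
  · intro i f j σ hg v hv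
    have := hw i f j σ hg v hv
    rw [hx, hx, T.vertexAt_eq_of_glue hg hv]
    change _ + w _ = _ + w _
    linarith
  · rw [isCanonical_iff]
    refine ⟨hxt, fun V => ⟨(c V).1, (c V).2, hcV V, ?_⟩⟩
    rw [hx, hcV, sub_self]

/-- A canonical vector is determined by its quadrilateral part. -/
theorem eq_of_isCanonical {x y : StdVec n} (hx : T.StdMatching x) (hy : T.StdMatching y)
    (hxc : T.IsCanonical x) (hyc : T.IsCanonical y) (h : quadProj x = quadProj y) : x = y := by
  obtain ⟨m, hm⟩ := StdMatching.exists_vertex_function T (hx.add_smul hy (-1)) (by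
    funext p
    have := congrFun h p
    simp only [quadProj] at this
    simp [quadProj, this])
  rw [isCanonical_iff] at hxc hyc
  simp only [Pi.add_apply, Pi.smul_apply, smul_eq_mul, neg_one_mul] at hm
  funext ⟨i, k⟩
  rcases k with v | k
  · have h1 : m (T.vertexAt i v) ≤ 0 := by
      obtain ⟨j, u, hu, h0⟩ := hxc.2 (T.vertexAt i v)
      rw [← hu, ← hm, h0]
      linarith [hyc.1 j u]
    have h2 : 0 ≤ m (T.vertexAt i v) := by
      obtain ⟨j, u, hu, h0⟩ := hyc.2 (T.vertexAt i v)
      rw [← hu, ← hm, h0]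
      linarith [hxc.1 j u]
    linarith [hm i v]
  · exact congrFun h (i, k)

end FaceGluing

/-! ### Extreme rays in the two coordinate systems -/

namespace FaceGluing

variable {n : ℕ} {T : FaceGluing n}

theorem QuadMatching.smul {q : QuadVec n} (hq : T.QuadMatching q) (a : ℝ) :
    T.QuadMatching (a • q) := by
  intro s hs
  simp only [Pi.smul_apply, smul_eq_mul, ← Finset.mul_sum, hq s hs]

theorem StdMatching.smul {w : StdVec n} (hw : T.StdMatching w) (a : ℝ) :
    T.StdMatching (a • w) := by
  intro i f j σ hg v hv
  simp only [Pi.smul_apply, smul_eq_mul, ← mul_add, hw i f j σ hg v hv]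

theorem sum_projImage {ι : Type*} [Fintype ι] {x : ι → ℝ} (h : ∑ c, x c ≠ 0) :
    ∑ c, projImage x c = 1 := by
  simp only [projImage, Pi.smul_apply, smul_eq_mul, ← Finset.mul_sum]
  exact inv_mul_cancel₀ h

theorem eq_zero_of_sum_eq_zero {ι : Type*} [Fintype ι] {x : ι → ℝ} (hx : ∀ c, 0 ≤ x c)
    (h : ∑ c, x c = 0) : x = 0 := by
  funext c
  exact (Finset.sum_eq_zero_iff_of_nonneg fun c _ => hx c).1 h c (Finset.mem_univ c)

theorem projImage_mem_quadSolutionSpace {q : QuadVec n} (h0 : ∀ c, 0 ≤ q c)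
    (hq : T.QuadMatching q) (h : ∑ c, q c ≠ 0) : projImage q ∈ T.quadSolutionSpace :=
  ⟨fun c => mul_nonneg (inv_nonneg.2 (Finset.sum_nonneg fun c _ => h0 c)) (h0 c),
    sum_projImage h, hq.smul _⟩

theorem sum_ne_zero_of_projImage_mem {q : QuadVec n} (h : projImage q ∈ T.quadSolutionSpace) :
    ∑ c, q c ≠ 0 := by
  intro h0
  have := h.2.1
  simp [projImage, h0] at this

/-- A summand of a vector on an extreme ray of the cone of solutions is a multiple of it. -/
theorem eq_smul_of_add_eq {q u v : QuadVec n}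
    (hq : projImage q ∈ T.quadSolutionSpace.extremePoints ℝ) (hu0 : ∀ c, 0 ≤ u c)
    (hv0 : ∀ c, 0 ≤ v c) (hu : T.QuadMatching u) (hv : T.QuadMatching v) (h : u + v = q) :
    u = ((∑ c, u c) / ∑ c, q c) • q := by
  have hs : ∑ c, u c + ∑ c, v c = ∑ c, q c := by
    rw [← h, ← Finset.sum_add_distrib]
    rfl
  have hq0 := sum_ne_zero_of_projImage_mem hq.1
  have hun : 0 ≤ ∑ c, u c := Finset.sum_nonneg fun c _ => hu0 c
  have hvn : 0 ≤ ∑ c, v c := Finset.sum_nonneg fun c _ => hv0 c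
  by_cases hu1 : ∑ c, u c = 0
  · rw [hu1, zero_div, zero_smul]
    exact eq_zero_of_sum_eq_zero hu0 hu1
  by_cases hv1 : ∑ c, v c = 0
  · rw [hv1, add_zero] at hs
    rw [eq_zero_of_sum_eq_zero hv0 hv1, add_zero] at h
    rw [hs, div_self hq0, one_smul, h]
  have hqpos : 0 < ∑ c, q c := lt_of_le_of_ne (by linarith) hq0.symm
  have hupos : 0 < ∑ c, u c := lt_of_le_of_ne hun (Ne.symm hu1)
  have hvpos : 0 < ∑ c, v c := lt_of_le_of_ne hvn (Ne.symm hv1)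
  have hseg : projImage q ∈ openSegment ℝ (projImage u) (projImage v) := by
    refine ⟨(∑ c, u c) / ∑ c, q c, (∑ c, v c) / ∑ c, q c, by positivity, by positivity, ?_, ?_⟩
    · rw [← add_div, hs, div_self hq0]
    · simp only [projImage, smul_smul]
      rw [div_mul_eq_mul_div, mul_inv_cancel₀ hu1, div_mul_eq_mul_div, mul_inv_cancel₀ hv1,
        one_div, ← smul_add, h]
  have key := (mem_extremePoints_iff_left.1 hq).2 _ (projImage_mem_quadSolutionSpace hu0 hu hu1)
    _ (projImage_mem_quadSolutionSpace hv0 hv hv1) hseg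
  calc u = (∑ c, u c) • projImage u := by
        rw [projImage, smul_smul, mul_inv_cancel₀ hu1, one_smul]
    _ = _ := by rw [key, projImage, smul_smul, div_eq_mul_inv]

/-- A canonical vector on an extreme ray in quadrilateral coordinates lies on an extreme ray in
standard coordinates. -/
theorem IsCanonical.projImage_mem_extremePoints {x : StdVec n} (hc : T.IsCanonical x)
    (h0 : ∀ c, 0 ≤ x c) (hx : T.StdMatching x)
    (hq : projImage (quadProj x) ∈ T.quadSolutionSpace.extremePoints ℝ) :
    projImage x ∈ T.stdSolutionSpace.extremePoints ℝ := by
  have hqs := sum_ne_zero_of_projImage_mem hq.1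
  have hX : ∑ c, x c ≠ 0 := by
    intro h
    rw [eq_zero_of_sum_eq_zero h0 h] at hqs
    exact hqs (Finset.sum_eq_zero fun _ _ => rfl)
  have hXpos : 0 < ∑ c, x c := lt_of_le_of_ne (Finset.sum_nonneg fun c _ => h0 c) hX.symm
  rw [mem_extremePoints_iff_left]
  refine ⟨⟨fun c => mul_nonneg (inv_nonneg.2 hXpos.le) (h0 c), sum_projImage hX, hx.smul _⟩, ?_⟩
  rintro y ⟨hy0, hy1, hy⟩ z ⟨hz0, hz1, hz⟩ ⟨a, b, ha, hb, -, hab⟩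
  set A := (∑ c, x c) * a with hA
  set B := (∑ c, x c) * b with hB
  have hApos : 0 < A := mul_pos hXpos ha
  have hBpos : 0 < B := mul_pos hXpos hb
  have hsum : A • y + B • z = x := by
    rw [hA, hB, mul_smul, mul_smul, ← smul_add, hab, projImage, smul_smul, mul_inv_cancel₀ hX,
      one_smul]
  have hsum' : ∀ c, A * y c + B * z c = x c := fun c => congrFun hsum c
  have hu := eq_smul_of_add_eq (u := quadProj (A • y)) (v := quadProj (B • z)) hq
    (fun c => mul_nonneg hApos.le (hy0 _)) (fun c => mul_nonneg hBpos.le (hz0 _))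
    (hy.smul A).quadMatching (hz.smul B).quadMatching (by rw [← hsum]; rfl)
  set r := (∑ c, quadProj (A • y) c) / ∑ c, quadProj x c
  obtain ⟨m, hm⟩ := StdMatching.exists_vertex_function T ((hy.smul A).add_smul hx (-r)) (by
    funext p
    have := congrFun hu p
    simp only [quadProj, Pi.smul_apply, smul_eq_mul] at this
    simp [quadProj, this])
  -- Where `x` vanishes, both non-negative summands vanish, which kills the coefficient of that
  -- vertex link.
  have hm0 : ∀ V, m V = 0 := by
    intro V
    obtain ⟨i, v, rfl, hv⟩ := ((isCanonical_iff T x).1 hc).2 V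
    have h1 := hsum' (i, Sum.inl v)
    have h2 := mul_nonneg hApos.le (hy0 (i, Sum.inl v))
    have h3 := mul_nonneg hBpos.le (hz0 (i, Sum.inl v))
    rw [← hm]
    simp only [Pi.add_apply, Pi.smul_apply, smul_eq_mul, hv]
    linarith
  have hyx : ∀ c, A * y c = r * x c := by
    rintro ⟨i, v | k⟩
    · have := hm i v
      simp only [Pi.add_apply, Pi.smul_apply, smul_eq_mul, hm0] at this
      linarith
    · exact congrFun hu (i, k)
  -- The normalisation of `y` to coordinate sum 1 determines the factor.
  have hAr : A = r * ∑ c, x c := by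
    rw [Finset.mul_sum, ← Finset.sum_congr rfl fun c _ => hyx c, ← Finset.mul_sum, hy1, mul_one]
  funext c
  have h4 := hyx c
  rw [hAr] at h4 hApos
  have hr : r ≠ 0 := by
    rintro h
    rw [h, zero_mul] at hApos
    exact hApos.false
  simp only [projImage, Pi.smul_apply, smul_eq_mul]
  field_simp
  apply mul_left_cancel₀ hr
  linarith

theorem exists_unique_canonicalExtension (hT : T.IsThreeManifold) {q : QuadVec n}
    (hq : q ∈ T.quadSolutionSet) : ∃ x : StdVec n,
      T.IsCanonicalExtension q x ∧ (∀ y, T.IsCanonicalExtension q y → y = x) ∧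
      projImage x ∈ T.stdSolutionSpace.extremePoints ℝ := by
  obtain ⟨x, hx⟩ := T.exists_isCanonicalExtension hT hq.1.1.1 hq.1.1.2.2 hq.2
  refine ⟨x, hx, fun y hy => ?_, ?_⟩
  · exact T.eq_of_isCanonical hy.1.2.1 hx.1.2.1 hy.2.1 hx.2.1 (hy.2.2.trans hx.2.2.symm)
  · refine hx.2.1.projImage_mem_extremePoints hx.1.1 hx.1.2.1 ?_
    have : projImage q = q := by rw [projImage, hq.1.1.2.1, inv_one, one_smul]
    rw [hx.2.2, this]
    exact hq.1

end FaceGluing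

/-! ### Arcs of normal discs in a face -/

/-- `v, b, c, f` are the four vertices of a tetrahedron. -/
abbrev AllVertices (v b c f : Fin 4) : Prop :=
  (v ≠ b ∧ v ≠ c ∧ v ≠ f) ∧ (b ≠ c ∧ b ≠ f) ∧ c ≠ f

namespace AllVertices

variable {v b c f : Fin 4}

theorem exists_fourth (hvb : v ≠ b) (hvf : v ≠ f) (hbf : b ≠ f) :
    ∃ c, AllVertices v b c f := by
  revert v b f
  decide

theorem exists_two (hvf : v ≠ f) : ∃ b c, AllVertices v b c f := by
  revert v f
  decide

theorem swap_middle (h : AllVertices v b c f) : AllVertices v c b f := by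
  revert v b c f
  decide

theorem swap_last (h : AllVertices v b c f) : AllVertices v b f c := by
  revert v b c f
  decide

theorem swap_first (h : AllVertices v b c f) : AllVertices b v c f := by
  revert v b c f
  decide

theorem map (h : AllVertices v b c f) (σ : Equiv.Perm (Fin 4)) :
    AllVertices (σ v) (σ b) (σ c) (σ f) := by
  simpa only [AllVertices, ne_eq, EmbeddingLike.apply_eq_iff_eq] using h

theorem eq_or (h : AllVertices v b c f) (a : Fin 4) : a = v ∨ a = b ∨ a = c ∨ a = f := by
  revert v b c f a
  decide

theorem sum_eq (h : AllVertices v b c f) (x : Fin 4 → ℝ) : ∑ a, x a = x v + x b + x c + x f := by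
  have hu : (Finset.univ : Finset (Fin 4)) = {v, b, c, f} := by
    revert v b c f
    decide
  rw [hu, Finset.sum_insert, Finset.sum_insert, Finset.sum_pair h.2.2]
  · ring
  · simp [h.2.1.1, h.2.1.2]
  · simp [h.1.1, h.1.2.1, h.1.2.2]

theorem quadType_opp (h : AllVertices v b c f) : quadType b c = quadType v f := by
  revert v b c f
  decide

theorem quadType_ne (h : AllVertices v b c f) : quadType v b ≠ quadType v f := by
  revert v b c f
  decide

end AllVertices

theorem quadType_comm (a b : Fin 4) : quadType a b = quadType b a := by
  revert a b
  decide

theorem DiscType.separates_comm {t : DiscType} {a b : Fin 4} :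
    t.Separates a b ↔ t.Separates b a := by
  cases t with
  | inl v => simp only [DiscType.Separates, ne_comm, or_comm]
  | inr k => simp only [DiscType.Separates, ne_comm (a := a), quadType_comm a]

namespace NormalDisc

variable {D E : NormalDisc} {v b c f : Fin 4}

/-- The arc of the disc in face `f` cuts off vertex `v`. -/
def Cuts (D : NormalDisc) (v f : Fin 4) : Prop :=
  v ≠ f ∧ (D.type = Sum.inl v ∨ D.type = Sum.inr (quadType v f))

theorem Cuts.separates (hD : D.Cuts v f) (h : AllVertices v b c f) : D.type.Separates v b := by
  rcases hD.2 with e | e <;> rw [e]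
  · exact ⟨h.1.1, .inl rfl⟩
  · exact ⟨h.1.1, h.quadType_ne⟩

theorem Cuts.not_separates (hD : D.Cuts v f) (h : AllVertices v b c f) :
    ¬ D.type.Separates b c := by
  rcases hD.2 with e | e <;> rw [e]
  · rintro ⟨-, h' | h'⟩
    · exact h.1.1 h'.symm
    · exact h.1.2.1 h'.symm
  · rintro ⟨-, h'⟩
    exact h' h.quadType_opp

theorem corner_comm (a b : Fin 4) : D.corner a b = D.corner b a := by
  rw [corner, corner, add_comm]

theorem corner_left (h : v ≠ b) : D.corner v b v = D.pos b v := by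
  simp [corner, h]

theorem corner_right (h : v ≠ b) : D.corner v b b = D.pos v b := by
  simp [corner, h.symm]

theorem corner_other (hv : c ≠ v) (hb : c ≠ b) : D.corner v b c = 0 := by
  simp [corner, hv, hb]

theorem Cuts.arc_eq (hD : D.Cuts v f) (h : AllVertices v b c f) :
    D.arc f = segment ℝ (D.corner v b) (D.corner v c) := by
  rw [arc, ← convexHull_pair]
  congr 1
  ext x
  simp only [Set.mem_ofPred_eq, Set.mem_insert_iff, Set.mem_singleton_iff]
  constructor
  · rintro ⟨a, a', ha, ha', hs, rfl⟩
    rcases h.eq_or a with rfl | rfl | rfl | rfl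
    · rcases h.eq_or a' with rfl | rfl | rfl | rfl
      · cases ht : D.type <;> rw [ht] at hs <;> exact absurd rfl hs.1
      · exact .inl rfl
      · exact .inr rfl
      · exact absurd rfl ha'
    · rcases h.eq_or a' with rfl | rfl | rfl | rfl
      · exact .inl (corner_comm _ _)
      · cases ht : D.type <;> rw [ht] at hs <;> exact absurd rfl hs.1
      · exact absurd hs (hD.not_separates h)
      · exact absurd rfl ha'
    · rcases h.eq_or a' with rfl | rfl | rfl | rfl
      · exact .inr (corner_comm _ _)
      · exact absurd hs (hD.not_separates h.swap_middle)
      · cases ht : D.type <;> rw [ht] at hs <;> exact absurd rfl hs.1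
      · exact absurd rfl ha'
    · exact absurd rfl ha
  · rintro (rfl | rfl)
    · exact ⟨v, b, h.1.2.2, h.2.1.2, hD.separates h, rfl⟩
    · exact ⟨v, c, h.1.2.2, h.2.2, hD.separates h.swap_middle, rfl⟩

theorem Cuts.corner_mem (hD : D.Cuts v f) (h : AllVertices v b c f) :
    D.corner v b ∈ D.arc f := by
  rw [hD.arc_eq h]
  exact left_mem_segment _ _ _

theorem Cuts.arc_nonempty (hD : D.Cuts v f) : (D.arc f).Nonempty := by
  obtain ⟨b, c, h⟩ := AllVertices.exists_two hD.1
  exact ⟨_, hD.corner_mem h⟩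

theorem arc_eq_empty (hD : D.type = Sum.inl f) : D.arc f = ∅ := by
  rw [arc, convexHull_eq_empty, Set.eq_empty_iff_forall_notMem]
  rintro x ⟨a, b, ha, hb, hs, -⟩
  rw [hD] at hs
  rcases hs.2 with h | h
  · exact ha h
  · exact hb h

theorem exists_cuts (hD : (D.arc f).Nonempty) : ∃ v, D.Cuts v f := by
  rcases ht : D.type with v | k
  · refine ⟨v, fun h => ?_, .inl ht⟩
    rw [arc_eq_empty (h ▸ ht)] at hD
    exact Set.not_nonempty_empty hD
  · obtain ⟨v, hv, hk⟩ : ∃ v, v ≠ f ∧ k = quadType v f :=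
      (by decide : ∀ (f : Fin 4) (k : Fin 3), ∃ v, v ≠ f ∧ k = quadType v f) f k
    exact ⟨v, hv, .inr (hk ▸ ht)⟩

theorem pos_lt_one (h : D.type.Separates v b) : D.pos v b < 1 := by
  have h1 := D.pos_add v b h
  have h2 := D.pos_pos b v (DiscType.separates_comm.1 h)
  linarith

/-- The arc that cuts off `v` in face `f`, by equations. -/
theorem Cuts.mem_arc_iff (hD : D.Cuts v f) (h : AllVertices v b c f) (x : Fin 4 → ℝ) :
    x ∈ D.arc f ↔ x f = 0 ∧ 0 ≤ x b ∧ 0 ≤ x c ∧ x v + x b + x c = 1 ∧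
      x b / D.pos v b + x c / D.pos v c = 1 := by
  have hb := D.pos_pos _ _ (hD.separates h)
  have hc := D.pos_pos _ _ (hD.separates h.swap_middle)
  have hb1 := D.pos_add _ _ (hD.separates h)
  have hc1 := D.pos_add _ _ (hD.separates h.swap_middle)
  rw [hD.arc_eq h]
  constructor
  · rintro ⟨α, β, hα, hβ, hαβ, rfl⟩
    have hv' : (α • D.corner v b + β • D.corner v c) v = α * D.pos b v + β * D.pos c v := by
      simp [corner_left h.1.1, corner_left h.1.2.1]
    have hb' : (α • D.corner v b + β • D.corner v c) b = α * D.pos v b := by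
      simp [corner_right h.1.1, corner_other h.1.1.symm h.2.1.1]
    have hc' : (α • D.corner v b + β • D.corner v c) c = β * D.pos v c := by
      simp [corner_right h.1.2.1, corner_other h.1.2.1.symm h.2.1.1.symm]
    have hf' : (α • D.corner v b + β • D.corner v c) f = 0 := by
      simp [corner_other h.1.2.2.symm h.2.1.2.symm, corner_other h.1.2.2.symm h.2.2.symm]
    rw [hv', hb', hc', hf']
    refine ⟨rfl, by positivity, by positivity, ?_, ?_⟩
    · linear_combination α * hb1 + β * hc1 + hαβ
    · rw [mul_div_cancel_right₀ _ hb.ne', mul_div_cancel_right₀ _ hc.ne', hαβ]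
  · rintro ⟨hf, hxb, hxc, hsum, hl⟩
    refine ⟨x b / D.pos v b, x c / D.pos v c, by positivity, by positivity, hl, ?_⟩
    funext a
    simp only [Pi.add_apply, Pi.smul_apply, smul_eq_mul]
    rcases h.eq_or a with rfl | rfl | rfl | rfl
    · rw [corner_left h.1.1, corner_left h.1.2.1]
      have e1 : x b / D.pos a b * D.pos b a = x b / D.pos a b - x b := by
        rw [← eq_sub_iff_add_eq'] at hb1
        rw [hb1, mul_sub, mul_one, div_mul_cancel₀ _ hb.ne']
      have e2 : x c / D.pos a c * D.pos c a = x c / D.pos a c - x c := by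
        rw [← eq_sub_iff_add_eq'] at hc1
        rw [hc1, mul_sub, mul_one, div_mul_cancel₀ _ hc.ne']
      rw [e1, e2]
      linarith
    · rw [corner_right h.1.1, corner_other h.1.1.symm h.2.1.1, div_mul_cancel₀ _ hb.ne']
      ring
    · rw [corner_right h.1.2.1, corner_other h.1.2.1.symm h.2.1.1.symm, div_mul_cancel₀ _ hc.ne']
      ring
    · rw [corner_other h.1.2.2.symm h.2.1.2.symm, corner_other h.1.2.2.symm h.2.2.symm, hf]
      ring

/-- Both ends lie inside edges at `v`. Each of the other two vertices of the face has coordinate 0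
at one end, so the vertex cut off can be read from the arc as a point set. -/
theorem Cuts.pos_of_mem (hD : D.Cuts v f) {x : Fin 4 → ℝ} (hx : x ∈ D.arc f) : 0 < x v := by
  obtain ⟨b, c, h⟩ := AllVertices.exists_two hD.1
  obtain ⟨α, β, hα, hβ, hαβ, rfl⟩ := (hD.arc_eq h) ▸ hx
  have hb := D.pos_pos _ _ (DiscType.separates_comm.1 (hD.separates h))
  have hc := D.pos_pos _ _ (DiscType.separates_comm.1 (hD.separates h.swap_middle))
  simp only [Pi.add_apply, Pi.smul_apply, smul_eq_mul, corner_left h.1.1, corner_left h.1.2.1]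
  rcases hα.eq_or_lt with rfl | hα
  · rw [zero_add] at hαβ
    rw [hαβ]
    linarith
  · have := mul_pos hα hb
    have := mul_nonneg hβ hc.le
    linarith

/-- The arc determines the vertex that is cut off. -/
theorem Cuts.eq_of_forall_pos (hD : D.Cuts v f) {u : Fin 4} (hu : u ≠ f)
    (h : ∀ x ∈ D.arc f, 0 < x u) : u = v := by
  by_contra hne
  obtain ⟨b, hb⟩ := AllVertices.exists_fourth (Ne.symm hne) hD.1 hu
  have := h _ (hD.corner_mem hb.swap_middle)
  rw [corner_other hb.1.1.symm hb.2.1.1] at this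
  exact this.false

/-- A disjoint arc in the same face lies on one side. -/
theorem Cuts.side (hD : D.Cuts v f) (h : AllVertices v b c f) {u : Fin 4} (hE : E.Cuts u f)
    (hdisj : Disjoint (D.arc f) (E.arc f)) :
    (∀ x ∈ E.arc f, 1 < x b / D.pos v b + x c / D.pos v c) ∨
      ∀ x ∈ E.arc f, x b / D.pos v b + x c / D.pos v c < 1 := by
  by_contra! hcon
  obtain ⟨⟨P, hP, hP1⟩, Q, hQ, hQ1⟩ := hcon
  -- Within the face, value 1 of this function describes the arc of `D`. The arc of `E` is
  -- connected, so if it took values on both sides of 1 it would meet that of `D`.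
  have hcont : Continuous fun x : Fin 4 → ℝ => x b / D.pos v b + x c / D.pos v c := by fun_prop
  have hconn : IsPreconnected (E.arc f) := (convex_convexHull ℝ _).isPreconnected
  obtain ⟨x, hx, hx1⟩ := hconn.intermediate_value hP hQ hcont.continuousOn ⟨hP1, hQ1⟩
  have hface : x f = 0 ∧ (∀ a, 0 ≤ x a) ∧ ∑ a, x a = 1 := by
    obtain ⟨b', c', h'⟩ := AllVertices.exists_two hE.1
    obtain ⟨h1, h2, h3, h4, -⟩ := (hE.mem_arc_iff h' x).1 hx
    refine ⟨h1, fun a => ?_, ?_⟩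
    · rcases h'.eq_or a with rfl | rfl | rfl | rfl
      · exact (hE.pos_of_mem hx).le
      · exact h2
      · exact h3
      · exact h1.ge
    · rw [h'.sum_eq, h1, h4, add_zero]
  refine Set.disjoint_left.1 hdisj ((hD.mem_arc_iff h x).2 ?_) hx
  refine ⟨hface.1, hface.2.1 b, hface.2.1 c, ?_, hx1⟩
  have := hface.2.2
  rw [h.sum_eq, hface.1, add_zero] at this
  exact this

theorem arc_subset_boundary (D : NormalDisc) (f : Fin 4) : D.arc f ⊆ D.boundary :=
  Set.subset_iUnion D.arc f

/-- Two disjoint arcs that cut off the same vertex are nested. -/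
theorem Cuts.pos_lt (hD : D.Cuts v f) (hE : E.Cuts v f) (h : AllVertices v b c f)
    (hdisj : Disjoint (D.arc f) (E.arc f)) (hlt : D.pos v b ≤ E.pos v b) :
    D.pos v c < E.pos v c := by
  have hb := D.pos_pos _ _ (hD.separates h)
  have hc := D.pos_pos _ _ (hD.separates h.swap_middle)
  rcases hD.side h hE hdisj with hs | hs
  · have := hs _ (hE.corner_mem h.swap_middle)
    rw [corner_right h.1.2.1, corner_other h.1.1.symm h.2.1.1, zero_div, zero_add,
      one_lt_div hc] at this
    exact this
  · have := hs _ (hE.corner_mem h)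
    rw [corner_right h.1.1, corner_other h.1.2.1.symm h.2.1.1.symm, zero_div, add_zero,
      div_lt_one hb] at this
    linarith

theorem Cuts.eq_pos_of_mem (hD : D.Cuts v f) (h : AllVertices v b c f) {x : Fin 4 → ℝ}
    (hx : x ∈ D.arc f) (hc : x c = 0) : x b = D.pos v b := by
  have h1 := ((hD.mem_arc_iff h x).1 hx).2.2.2.2
  rw [hc, zero_div, add_zero, div_eq_one_iff_eq (D.pos_pos _ _ (hD.separates h)).ne'] at h1
  exact h1

theorem corner_eq_of_pos_eq (hD : D.type.Separates v b) (hE : E.type.Separates v b)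
    (h : D.pos v b = E.pos v b) : D.corner v b = E.corner v b := by
  have h1 := D.pos_add _ _ hD
  have h2 := E.pos_add _ _ hE
  have h3 : D.pos b v = E.pos b v := by linarith
  rw [corner, corner, h, h3]

end NormalDisc

theorem faceMap_apply (σ : Equiv.Perm (Fin 4)) (x : Fin 4 → ℝ) (v : Fin 4) :
    faceMap σ x (σ v) = x v := by
  simp [faceMap]

theorem faceMap_inv_image (σ : Equiv.Perm (Fin 4)) (A : Set (Fin 4 → ℝ)) :
    faceMap σ⁻¹ '' (faceMap σ '' A) = A := by
  rw [Set.image_image]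
  convert Set.image_id A using 2 with x
  funext v
  simp [faceMap]

namespace NormalDisc

variable {D E : NormalDisc} {v b c f : Fin 4} {σ : Equiv.Perm (Fin 4)}

theorem Cuts.map (hD : D.Cuts v f) (hE : E.arc (σ f) = faceMap σ '' D.arc f) :
    E.Cuts (σ v) (σ f) := by
  obtain ⟨u, hu⟩ : ∃ u, E.Cuts u (σ f) := by
    apply exists_cuts
    rw [hE]
    exact hD.arc_nonempty.image _
  rwa [hu.eq_of_forall_pos (σ.injective.ne hD.1) ?_]
  rw [hE]
  rintro _ ⟨x, hx, rfl⟩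
  rw [faceMap_apply]
  exact hD.pos_of_mem hx

/-- The position on the edge `vb` is the `b`-coordinate of the point of the arc with vanishing
`c`-coordinate, and `faceMap` only permutes coordinates. -/
theorem Cuts.pos_map (hD : D.Cuts v f) (hE : E.arc (σ f) = faceMap σ '' D.arc f)
    (h : AllVertices v b c f) : E.pos (σ v) (σ b) = D.pos v b := by
  have hx : faceMap σ (D.corner v b) ∈ E.arc (σ f) := hE ▸ ⟨_, hD.corner_mem h, rfl⟩
  rw [← (hD.map hE).eq_pos_of_mem (h.map σ) hx, faceMap_apply, corner_right h.1.1]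
  rw [faceMap_apply, corner_other h.1.2.1.symm h.2.1.1.symm]

end NormalDisc

/-! ### Innermost triangles and the canonical part of a surface -/

namespace NormalSurface

open NormalDisc

variable {n : ℕ} {T : FaceGluing n} (S : NormalSurface T) {i j : Fin n} {v b c f : Fin 4}
  {σ : Equiv.Perm (Fin 4)} {D E : NormalDisc}

variable {S} in
theorem disjoint_arc (hD : D ∈ S.discs i) (hE : E ∈ S.discs i) (h : D ≠ E) (f : Fin 4) :
    Disjoint (D.arc f) (E.arc f) :=
  (S.disjoint i hD hE h).mono (arc_subset_boundary D f) (arc_subset_boundary E f)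

variable {S} in
theorem eq_of_mem_arc (hD : D ∈ S.discs i) (hE : E ∈ S.discs i) {x : Fin 4 → ℝ}
    (h : x ∈ D.arc f) (h' : x ∈ E.arc f) : D = E := by
  by_contra hne
  exact Set.disjoint_left.1 (disjoint_arc hD hE hne f) h h'

variable {S} in
theorem eq_of_pos_eq (hD : D ∈ S.discs i) (hE : E ∈ S.discs i) (hDc : D.Cuts v f)
    (hEc : E.Cuts v f) (h : AllVertices v b c f) (hpos : D.pos v b = E.pos v b) : D = E := by
  refine eq_of_mem_arc hD hE (hDc.corner_mem h) ?_
  rw [corner_eq_of_pos_eq (hDc.separates h) (hEc.separates h) hpos]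
  exact hEc.corner_mem h

/-- Passing to a matching disc is injective: two discs with the same partner have the same arc, but
distinct discs of the surface are disjoint. The inverse gluing gives the opposite inequality. -/
theorem ncard_cuts_le (hg : T.glue i f = some (j, σ)) (v : Fin 4) :
    {D | D ∈ S.discs i ∧ D.Cuts v f}.ncard ≤
      {D | D ∈ S.discs j ∧ D.Cuts (σ v) (σ f)}.ncard := by
  have hex : ∀ D, D ∈ S.discs i ∧ D.Cuts v f →
      ∃ E, E ∈ S.discs j ∧ E.arc (σ f) = faceMap σ '' D.arc f := fun D hD =>
    S.matching i f j σ hg D hD.1 hD.2.arc_nonempty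
  choose! φ hφ harc using hex
  refine Set.ncard_le_ncard_of_injOn φ (fun D hD => ⟨hφ D hD, hD.2.map (harc D hD)⟩) ?_
    ((S.finite j).subset fun _ h => h.1)
  intro D hD E hE he
  have himg : faceMap σ '' D.arc f = faceMap σ '' E.arc f := by
    rw [← harc D hD, ← harc E hE, he]
  have himg' : D.arc f = E.arc f := by
    rw [← faceMap_inv_image σ (D.arc f), himg, faceMap_inv_image]
  obtain ⟨x, hx⟩ := hD.2.arc_nonempty
  exact eq_of_mem_arc hD.1 hE.1 hx (himg' ▸ hx)

theorem stdRep_apply (i : Fin n) (t : DiscType) :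
    S.stdRep (i, t) = ({D | D ∈ S.discs i ∧ D.type = t}.ncard : ℝ) := rfl

theorem stdRep_nonneg (d : Fin n × DiscType) : 0 ≤ S.stdRep d := Nat.cast_nonneg _

theorem stdRep_add (i : Fin n) (h : v ≠ f) :
    S.stdRep (i, Sum.inl v) + S.stdRep (i, Sum.inr (quadType v f)) =
      ({D | D ∈ S.discs i ∧ D.Cuts v f}.ncard : ℝ) := by
  rw [stdRep_apply, stdRep_apply, ← Nat.cast_add, ← Set.ncard_union_eq ?_
    ((S.finite i).subset fun _ h => h.1) ((S.finite i).subset fun _ h => h.1)]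
  · congr 2
    ext D
    simp only [Set.mem_union, Set.mem_ofPred_eq, Cuts]
    tauto
  · rw [Set.disjoint_left]
    rintro D ⟨-, h1⟩ ⟨-, h2⟩
    rw [h1] at h2
    cases h2

theorem stdMatching_stdRep : T.StdMatching S.stdRep := by
  intro i f j σ hg v hv
  rw [S.stdRep_add i hv, S.stdRep_add j (σ.injective.ne hv)]
  congr 1
  refine le_antisymm (S.ncard_cuts_le hg v) ?_
  have := S.ncard_cuts_le (T.symm i f j σ hg) (σ v)
  simpa using this

/-- `D` is the triangle closest to vertex `v` of tetrahedron `i`. -/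
def Innermost (i : Fin n) (v : Fin 4) (D : NormalDisc) : Prop :=
  D ∈ S.discs i ∧ D.type = Sum.inl v ∧
    ∀ E ∈ S.discs i, E.type = Sum.inl v → ∀ b, b ≠ v → D.pos v b ≤ E.pos v b

theorem cuts_of_type (hD : D.type = Sum.inl v) (h : v ≠ f) : D.Cuts v f := ⟨h, .inl hD⟩

/-- Disjoint triangles at a corner are nested, so one that is closest along a single edge is closest
along all three. -/
theorem exists_innermost (h : S.stdRep (i, Sum.inl v) ≠ 0) : ∃ D, S.Innermost i v D := by
  rw [stdRep_apply, Nat.cast_ne_zero, ← Nat.pos_iff_ne_zero,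
    Set.ncard_pos ((S.finite i).subset fun _ h => h.1)] at h
  obtain ⟨b, hb⟩ : ∃ b, b ≠ v := exists_ne v
  obtain ⟨D, ⟨hD, ht⟩, hmin⟩ := Set.exists_min_image _ (fun D : NormalDisc => D.pos v b)
    ((S.finite i).subset fun _ h => h.1) h
  refine ⟨D, hD, ht, fun E hE hEt c hc => ?_⟩
  by_cases hbc : b = c
  · exact hbc ▸ hmin E ⟨hE, hEt⟩
  · by_cases hDE : D = E
    · rw [hDE]
    obtain ⟨f, hf⟩ := AllVertices.exists_fourth hb hbc hc.symm
    have h4 : AllVertices v b c f := hf.swap_last.swap_first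
    exact ((cuts_of_type ht h4.1.2.2).pos_lt (cuts_of_type hEt h4.1.2.2) h4
      (disjoint_arc hD hE hDE f) (hmin E ⟨hE, hEt⟩)).le

variable {S} in
/-- The innermost triangle is closer to the vertex than all arcs that cut it off. -/
theorem Innermost.pos_le (hD : S.Innermost i v D) (hE : E ∈ S.discs i) (hEc : E.Cuts v f)
    (h : AllVertices v b c f) : D.pos v b ≤ E.pos v b := by
  rcases hEc.2 with ht | ht
  · exact hD.2.2 E hE ht b h.1.1.symm
  · have h' : AllVertices v b f c := h.swap_last
    have hDE : D ≠ E := by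
      rintro rfl
      rw [hD.2.1] at ht
      cases ht
    -- For a quadrilateral the comparison is made in the face opposite `c`, which also contains the
    -- edge `vb`; there `E` cuts off `b` while `D` cuts off `v`.
    have hEb : E.Cuts b c := ⟨h.2.1.1, .inr (by rw [ht, h.quadType_opp])⟩
    have hDv : D.Cuts v c := cuts_of_type hD.2.1 h.1.2.1
    have hb := D.pos_pos _ _ (hDv.separates h')
    have hf := D.pos_pos _ _ (hDv.separates h'.swap_middle)
    have hf1 := pos_lt_one (hDv.separates h'.swap_middle)
    have hb1 := pos_lt_one (hDv.separates h')
    have h'' : AllVertices b v f c := h'.swap_first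
    have hside := hDv.side h' hEb (disjoint_arc hD.1 hE hDE c)
    have m1 := hEb.corner_mem h''.swap_middle
    have m2 := hEb.corner_mem h''
    rcases hside with hs | hs
    · have := hs _ m2
      rw [corner_left h''.1.1, corner_other h''.1.2.1.symm h''.2.1.1.symm, zero_div, add_zero,
        one_lt_div hb] at this
      exact this.le
    -- `E` cannot lie on the side of `v`: its end on the edge `bf` has coordinates of sum 1, and
    -- dividing them by positions below 1 cannot decrease the sum.
    · have := hs _ m1
      rw [corner_left h''.1.2.1, corner_right h''.1.2.1] at this
      have hsum := E.pos_add _ _ (hEb.separates h''.swap_middle)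
      have p1 := E.pos_pos _ _ (hEb.separates h''.swap_middle)
      have p2 := E.pos_pos _ _ (DiscType.separates_comm.1 (hEb.separates h''.swap_middle))
      have q1 : E.pos b f ≤ E.pos b f / D.pos v f := by
        rw [le_div_iff₀ hf]
        nlinarith
      have q2 : E.pos f b ≤ E.pos f b / D.pos v b := by
        rw [le_div_iff₀ hb]
        nlinarith
      linarith

variable {S} in
theorem Innermost.unique (hD : S.Innermost i v D) (hE : S.Innermost i v E) : D = E := by
  obtain ⟨f, hf⟩ : ∃ f, v ≠ f := (exists_ne v).imp fun _ h => h.symm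
  obtain ⟨b, c, h⟩ := AllVertices.exists_two hf
  exact eq_of_pos_eq hD.1 hE.1 (cuts_of_type hD.2.1 hf) (cuts_of_type hE.2.1 hf) h
    (le_antisymm (hD.2.2 E hE.1 hE.2.1 b h.1.1.symm) (hE.2.2 D hD.1 hD.2.1 b h.1.1.symm))

variable {S} in
/-- Innermost triangles are joined only to innermost triangles. -/
theorem Innermost.eq_of_arc_eq (hD : S.Innermost i v D) (hg : T.glue i f = some (j, σ))
    (hv : v ≠ f) {D' : NormalDisc} (hD' : D' ∈ S.discs j)
    (harc : D'.arc (σ f) = faceMap σ '' D.arc f) (hE : S.Innermost j (σ v) E) : D' = E := by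
  have hDc : D.Cuts v f := cuts_of_type hD.2.1 hv
  have hD'c := hDc.map harc
  have hEc : E.Cuts (σ v) (σ f) := cuts_of_type hE.2.1 (σ.injective.ne hv)
  obtain ⟨b, c, h⟩ := AllVertices.exists_two hv
  obtain ⟨F, hF, hFarc⟩ := S.matching _ _ _ _ (T.symm _ _ _ _ hg) E hE.1 hEc.arc_nonempty
  have hFc := hEc.map hFarc
  have hFpos := hEc.pos_map hFarc (h.map σ)
  simp only [Equiv.Perm.inv_def, Equiv.symm_apply_apply] at hFc hFpos
  -- Let `F` be the partner of `E` on the side of `D`. Along the edge `vb` the positions satisfy `D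
  -- ≤ F = E ≤ D' = D`, so `D'` and `E` meet and coincide.
  have h1 := hD.pos_le hF hFc h
  have h2 := hE.pos_le hD' hD'c (h.map σ)
  rw [hDc.pos_map harc h] at h2
  refine eq_of_pos_eq hD' hE.1 hD'c hEc (h.map σ) ?_
  rw [hDc.pos_map harc h]
  linarith

variable {S} in
theorem Joined.symm {p q : Fin n × NormalDisc} (h : S.Joined p q) : S.Joined q p := by
  obtain ⟨hp, hq, f, σ, hg, hne, harc⟩ := h
  refine ⟨hq, hp, σ f, σ⁻¹, T.symm _ _ _ _ hg, ?_, ?_⟩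
  · rw [harc]
    exact hne.image _
  · rw [harc, faceMap_inv_image, Equiv.Perm.inv_def, Equiv.symm_apply_apply]

-- Components are removed as a whole, so joining in `S` does not leave the canonical part. Thus
-- triangles innermost in the canonical part can be followed through components of `S`.
variable {S} in
theorem Joined.mem_canonicalPart {p q : Fin n × NormalDisc} (h : S.Joined p q)
    (hp : p ∈ S.canonicalPart.allDiscs) : q ∈ S.canonicalPart.allDiscs :=
  ⟨h.2.1, fun hq => hp.2 (S.inVertexLink_of_joined h hq)⟩

/-- The innermost triangles of the canonical part around a vertex. -/
def innermostLink (V : T.Vertex) : Set (Fin n × NormalDisc) :=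
  {p | ∃ v, T.vertexAt p.1 v = V ∧ S.canonicalPart.Innermost p.1 v p.2}

variable {V : T.Vertex}

theorem innermostLink_of_joined
    (hV : ∀ i v, T.vertexAt i v = V → ∃ D, S.canonicalPart.Innermost i v D)
    {p q : Fin n × NormalDisc} (h : S.Joined p q) (hp : p ∈ S.innermostLink V) :
    q ∈ S.innermostLink V := by
  obtain ⟨v, hv, hD⟩ := hp
  have hq := h.mem_canonicalPart hD.1
  obtain ⟨-, -, f, σ, hg, hne, harc⟩ := h
  have hvf : v ≠ f := by
    rintro rfl
    rw [arc_eq_empty hD.2.1] at hne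
    exact Set.not_nonempty_empty hne
  have hV' : T.vertexAt q.1 (σ v) = V := (T.vertexAt_eq_of_glue hg hvf).trans hv
  obtain ⟨E, hE⟩ := hV _ _ hV'
  refine ⟨σ v, hV', ?_⟩
  rwa [hD.eq_of_arc_eq hg hvf hq harc hE]

/-- A chain of glued corners lifts to a chain of joined innermost triangles; this is the
connectedness of the vertex link. -/
theorem eqvGen_joined_of_cornerGlued
    (hV : ∀ i v, T.vertexAt i v = V → ∃ D, S.canonicalPart.Innermost i v D)
    {c d : Fin n × Fin 4} (hcd : Relation.EqvGen T.CornerGlued c d)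
    (hc : T.vertexAt c.1 c.2 = V) {D E : NormalDisc} (hD : S.canonicalPart.Innermost c.1 c.2 D)
    (hE : S.canonicalPart.Innermost d.1 d.2 E) :
    Relation.EqvGen S.Joined (c.1, D) (d.1, E) := by
  induction hcd generalizing D E with
  | rel c d h =>
    obtain ⟨f, σ, hf, hg, hd⟩ := h
    have hDc : D.Cuts c.2 f := cuts_of_type hD.2.1 hf
    obtain ⟨D', hD', harc⟩ := S.canonicalPart.matching _ _ _ _ hg D hD.1 hDc.arc_nonempty
    rw [hd] at hE
    obtain rfl := hD.eq_of_arc_eq hg hf hD' harc hE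
    exact .rel _ _ ⟨hD.1.1, hD'.1, f, σ, hg, hDc.arc_nonempty, harc⟩
  | refl c =>
    rw [hD.unique hE]
    exact .refl _
  | symm c d h ih =>
    exact .symm _ _ (ih ((Quot.eqvGen_sound h).trans hc) hE hD)
  | trans c d e h h' ih ih' =>
    have hd : T.vertexAt d.1 d.2 = V := (Quot.eqvGen_sound h).symm.trans hc
    obtain ⟨F, hF⟩ := hV _ _ hd
    exact .trans _ _ _ (ih hc hD hF) (ih' hd hF hE)

theorem component_eq_innermostLink
    (hV : ∀ i v, T.vertexAt i v = V → ∃ D, S.canonicalPart.Innermost i v D)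
    {p : Fin n × NormalDisc} (hp : p ∈ S.innermostLink V) :
    S.component p = S.innermostLink V := by
  ext q
  constructor
  · intro h
    change Relation.EqvGen S.Joined p q at h
    have key : p ∈ S.innermostLink V ↔ q ∈ S.innermostLink V := by
      clear hp
      induction h with
      | rel x y h =>
        exact ⟨S.innermostLink_of_joined hV h, S.innermostLink_of_joined hV h.symm⟩
      | refl x => rfl
      | symm x y h ih => exact ih.symm
      | trans x y z h h' ih ih' => exact ih.trans ih'
    exact key.1 hp
  · rintro ⟨u, hu, hE⟩
    obtain ⟨v, hv, hD⟩ := hp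
    exact S.eqvGen_joined_of_cornerGlued hV (c := (p.1, v)) (d := (q.1, u))
      (Quot.eqvGen_exact (hv.trans hu.symm)) hv hD hE

theorem discCount_innermostLink
    (hV : ∀ i v, T.vertexAt i v = V → ∃ D, S.canonicalPart.Innermost i v D) :
    discCount (S.innermostLink V) = T.vertexLink V := by
  classical
  funext ⟨i, t⟩
  rcases t with v | k
  · simp only [discCount, FaceGluing.vertexLink]
    split_ifs with h
    · obtain ⟨D, hD⟩ := hV i v h
      have : {E | (i, E) ∈ S.innermostLink V ∧ E.type = Sum.inl v} = {D} := by
        ext E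
        simp only [Set.mem_ofPred_eq, Set.mem_singleton_iff]
        constructor
        · rintro ⟨⟨u, -, hE⟩, ht⟩
          obtain rfl : u = v := Sum.inl.inj (hE.2.1.symm.trans ht)
          exact hE.unique hD
        · rintro rfl
          exact ⟨⟨v, h, hD⟩, hD.2.1⟩
      rw [this, Set.ncard_singleton, Nat.cast_one]
    · have : {E | (i, E) ∈ S.innermostLink V ∧ E.type = Sum.inl v} = ∅ := by
        rw [Set.eq_empty_iff_forall_notMem]
        rintro E ⟨⟨u, hu, hE⟩, ht⟩
        obtain rfl : u = v := Sum.inl.inj (hE.2.1.symm.trans ht)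
        exact h hu
      rw [this, Set.ncard_empty, Nat.cast_zero]
  · have : {E | (i, E) ∈ S.innermostLink V ∧ E.type = Sum.inr k} = ∅ := by
      rw [Set.eq_empty_iff_forall_notMem]
      rintro E ⟨⟨u, -, hE⟩, ht⟩
      cases hE.2.1.symm.trans ht
    simp only [discCount, FaceGluing.vertexLink]
    rw [this, Set.ncard_empty, Nat.cast_zero]

/-- The canonical part of a surface has a canonical vector. -/
theorem isCanonical_stdRep_canonicalPart : T.IsCanonical S.canonicalPart.stdRep := by
  rw [FaceGluing.isCanonical_iff]
  refine ⟨fun i v => stdRep_nonneg _ _, fun V => ?_⟩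
  by_contra! hne
  have hV : ∀ i v, T.vertexAt i v = V → ∃ D, S.canonicalPart.Innermost i v D :=
    fun i v h => S.canonicalPart.exists_innermost (hne i v h)
  obtain ⟨s, hs⟩ := T.exists_edgeStart V
  obtain ⟨D, hD⟩ := hV _ _ hs
  -- `D` belongs to the canonical part, but its component in `S` would be a link of `V`.
  refine hD.1.2 ⟨V, ?_⟩
  rw [S.component_eq_innermostLink hV ⟨_, hs, hD⟩, S.discCount_innermostLink hV]

theorem component_subset {p : Fin n × NormalDisc} (hp : p ∈ S.allDiscs) :
    S.component p ⊆ S.allDiscs := by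
  intro q h
  change Relation.EqvGen S.Joined p q at h
  have key : p ∈ S.allDiscs ↔ q ∈ S.allDiscs := by
    clear hp
    induction h with
    | rel x y h => exact ⟨fun _ => h.2.1, fun _ => h.1⟩
    | refl x => rfl
    | symm x y h ih => exact ih.symm
    | trans x y z h h' ih ih' => exact ih.trans ih'
  exact key.1 hp

/-- Quadrilaterals do not lie in vertex links. -/
theorem not_inVertexLink_of_quad (hD : D ∈ S.discs i) {k : Fin 3} (ht : D.type = Sum.inr k) :
    ¬ S.InVertexLink (i, D) := by
  rintro ⟨V, hV⟩
  have h0 := congrFun hV (i, Sum.inr k)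
  simp only [discCount, FaceGluing.vertexLink, Nat.cast_eq_zero] at h0
  rw [Set.ncard_eq_zero ((S.finite i).subset fun E hE => S.component_subset hD hE.1)] at h0
  exact Set.eq_empty_iff_forall_notMem.1 h0 D ⟨.refl _, ht⟩

theorem quadProj_stdRep_canonicalPart : quadProj S.canonicalPart.stdRep = S.quadRep := by
  funext ⟨i, k⟩
  change S.canonicalPart.stdRep (i, Sum.inr k) = _
  rw [stdRep_apply, quadRep]
  congr 2
  ext D
  exact ⟨fun h => ⟨h.1.1, h.2⟩, fun h => ⟨⟨h.1, S.not_inVertexLink_of_quad h.1 h.2⟩, h.2⟩⟩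

theorem IsQuadVertex.isStdVertex_canonicalPart {S : NormalSurface T} (hS : S.IsQuadVertex) :
    S.canonicalPart.IsStdVertex :=
  S.isCanonical_stdRep_canonicalPart.projImage_mem_extremePoints (stdRep_nonneg _)
    (stdMatching_stdRep _) (by rwa [quadProj_stdRep_canonicalPart])

end NormalSurface

end NormalSurf

theorem mainTheorem4 (n : ℕ) (T : NormalSurf.FaceGluing n) (hT : T.IsThreeManifold) :
    (∀ S : NormalSurf.NormalSurface T, S.IsQuadVertex → S.canonicalPart.IsStdVertex) ∧
    (∀ q ∈ T.quadSolutionSet, ∃ x : NormalSurf.StdVec n,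
      T.IsCanonicalExtension q x ∧ (∀ y, T.IsCanonicalExtension q y → y = x) ∧
      NormalSurf.projImage x ∈ T.stdSolutionSpace.extremePoints ℝ) :=
  ⟨fun _ hS => hS.isStdVertex_canonicalPart,
    fun _ hq => NormalSurf.FaceGluing.exists_unique_canonicalExtension hT hq⟩
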